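/- Let $G$ be a connected (real, finite-dimensional) Lie group with Lie algebra $\mathfrak g$, let $M$ be a closed smooth manifold (compact, Hausdorff, without boundary), and let $\alpha: G\times M\to M$ be a smooth action which is minimal (every orbit is dense) and which preserves some Borel probability measure on $M$. Let $H^1(\alpha)$ denote the first Chevalley–Eilenberg cohomology of $\mathfrak g$ with coefficients in $C^\infty(M,\mathbb C)$, on which $X\in\mathfrak g$ acts by $(X\cdot u)(x)=\frac{d}{dt}\big|_{t=0}u(\alpha(\exp(-tX),x))$; that is, $H^1(\alpha)=Z^1/B^1$, where $Z^1$ is the space of linear maps $\eta:\mathfrak g\to C^\infty(M,\mathbb C)$ with $X\cdot\eta(Y)-Y\cdot\eta(X)-\eta([X,Y])=0$ for all $X,Y\in\mathfrak g$, and $B^1$ is the space of maps $X\mapsto X\cdot u$ with $u\in C^\infty(M,\mathbb C)$. Let $H^1(\mathfrak g)$ denote the first cohomology of $\mathfrak g$ with coefficients in the trivial representation $\mathbb C$. Suppose that $H^1(\alpha)=H^1(\mathfrak g)$, in the sense that the natural map $H^1(\mathfrak g)\to H^1(\alpha)$, induced by sending $c:\mathfrak g\to\mathbb C$ to the map $X\mapsto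 c(X)\cdot 1$, is bijective. Let $b_1(M)=\dim_{\mathbb R}H^1(M;\mathbb R)$ be the first Betti number of $M$ (with $H^1(M;\mathbb R)$ the de Rham cohomology, closed smooth 1-forms modulo exact ones). Then there are a smooth surjective submersion $\pi: M\to\mathbb T^{b_1(M)}$ and a smooth homomorphism $\tau: G\to\mathbb T^{b_1(M)}$ such that $\pi(\alpha(g,x))=\tau(g)\,\pi(x)$ for all $g\in G$ and $x\in M$; that is, $\pi$ semiconjugates $\alpha$ to an action of $G$ on $\mathbb T^{b_1(M)}$ by translations. -/

import Mathlib

open MeasureTheory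
open scoped Manifold ContDiff

noncomputable section

/-! ### Degree-one Chevalley–Eilenberg cohomology -/

namespace ChevalleyEilenberg

variable {g V W : Type*} [LieRing g] [LieAlgebra ℝ g] [AddCommGroup V] [Module ℝ V]
  [AddCommGroup W] [Module ℝ W]

/-- The differential `C⁰ = V → C¹ = Hom(g, V)`, `(d v)(X) = ρ(X) v`. -/
def d₀ (ρ : g →ₗ[ℝ] Module.End ℝ V) : V →ₗ[ℝ] (g →ₗ[ℝ] V) := ρ.flip

/-- The differential `C¹ = Hom(g, V) → C²`,
`(d η)(X, Y) = ρ(X) η(Y) - ρ(Y) η(X) - η([X, Y])`. -/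
def d₁ (ρ : g →ₗ[ℝ] Module.End ℝ V) : (g →ₗ[ℝ] V) →ₗ[ℝ] (g →ₗ[ℝ] g →ₗ[ℝ] V) where
  toFun η := LinearMap.mk₂ ℝ (fun X Y => ρ X (η Y) - ρ Y (η X) - η ⁅X, Y⁆)
    (fun X X' Y => by simp; abel)
    (fun c X Y => by simp [smul_sub])
    (fun X Y Y' => by simp; abel)
    (fun c X Y => by simp [smul_sub])
  map_add' η η' := by ext X Y; simp; abel
  map_smul' c η := by ext X Y; simp [smul_sub]

/-- The 1-cocycles `Z¹(ρ)`. -/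
def Z1 (ρ : g →ₗ[ℝ] Module.End ℝ V) : Submodule ℝ (g →ₗ[ℝ] V) := LinearMap.ker (d₁ ρ)

/-- The 1-coboundaries `B¹(ρ)`. -/
def B1 (ρ : g →ₗ[ℝ] Module.End ℝ V) : Submodule ℝ (g →ₗ[ℝ] V) := LinearMap.range (d₀ ρ)

/-- The first cohomology `H¹(ρ) = Z¹(ρ) / B¹(ρ)`. (When `ρ` is a representation, `B¹ ≤ Z¹`.) -/
abbrev H1 (ρ : g →ₗ[ℝ] Module.End ℝ V) : Type _ := Z1 ρ ⧸ (B1 ρ).submoduleOf (Z1 ρ)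

/-- The map on 1-cocycles induced by an intertwining map `T : V → W`, `η ↦ T ∘ η`. -/
def mapZ1 {ρ : g →ₗ[ℝ] Module.End ℝ V} {σ : g →ₗ[ℝ] Module.End ℝ W} (T : V →ₗ[ℝ] W)
    (hT : ∀ X v, T (ρ X v) = σ X (T v)) : Z1 ρ →ₗ[ℝ] Z1 σ :=
  (LinearMap.compRight ℝ T : (g →ₗ[ℝ] V) →ₗ[ℝ] (g →ₗ[ℝ] W)).restrict (by
    intro η hη
    have h : d₁ ρ η = 0 := hη
    change d₁ σ _ = 0
    ext X Y
    have h2 := congrArg T (congrArg (fun f => f X Y) h)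
    simpa [d₁, hT] using h2)

/-- The map `H¹(ρ) → H¹(σ)` induced by an intertwining map. -/
def mapH1 {ρ : g →ₗ[ℝ] Module.End ℝ V} {σ : g →ₗ[ℝ] Module.End ℝ W} (T : V →ₗ[ℝ] W)
    (hT : ∀ X v, T (ρ X v) = σ X (T v)) : H1 ρ →ₗ[ℝ] H1 σ :=
  Submodule.mapQ _ _ (mapZ1 T hT) (by
    rintro ⟨η, hη⟩ ⟨v, hv⟩
    refine ⟨T v, ?_⟩
    have hv' : d₀ ρ v = η := hv
    subst hv'
    ext X
    simp [d₀, mapZ1, hT])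

end ChevalleyEilenberg

/-! ### The cohomology of a smooth action -/

section Action

variable {EG HG : Type*} [NormedAddCommGroup EG] [NormedSpace ℝ EG]
  [TopologicalSpace HG] {IG : ModelWithCorners ℝ EG HG}
  {G : Type*} [TopologicalSpace G] [ChartedSpace HG G] [Group G]
  {EM HM : Type*} [NormedAddCommGroup EM] [NormedSpace ℝ EM] [TopologicalSpace HM]
  {IM : ModelWithCorners ℝ EM HM} {M : Type*} [TopologicalSpace M] [ChartedSpace HM M]

/-- A smooth real Lie group has the regularity which Mathlib requires for its Lie algebra. -/
instance instLieGroupMinSmoothness [LieGroup IG ∞ G] : LieGroup IG (minSmoothness ℝ 3) G := by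
  rw [minSmoothness_of_isRCLikeNormedField]; infer_instance

variable [LieGroup IG ∞ G] [MulAction G M] [ContMDiffSMul IG IM ∞ G M]

theorem contMDiff_inv_smul_comp (u : C^∞⟮IM, M; 𝓘(ℝ, ℂ), ℂ⟯) :
    ContMDiff (IG.prod IM) 𝓘(ℝ, ℂ) ∞ (fun p : G × M => u (p.1⁻¹ • p.2)) := by
  have h : ContMDiff (IG.prod IM) IM ∞ (fun p : G × M => p.1⁻¹ • p.2) :=
    (ContMDiffSMul.contMDiff_smul (I := IG) (I' := IM) (n := ∞) (G := G) (M := M)).comp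
      ((contMDiff_fst.inv).prodMk contMDiff_snd)
  exact u.contMDiff.comp h

theorem mdifferentiableAt_inv_smul_comp (u : C^∞⟮IM, M; 𝓘(ℝ, ℂ), ℂ⟯) (x : M) (g : G) :
    MDifferentiableAt IG 𝓘(ℝ, ℂ) (fun g : G => u (g⁻¹ • x)) g :=
  (((contMDiff_inv_smul_comp (IG := IG) (G := G) u).comp
    (contMDiff_id.prodMk contMDiff_const)).mdifferentiable (by simp)) g

theorem contMDiff_infinitesimal [IsManifold IM ∞ M] (u : C^∞⟮IM, M; 𝓘(ℝ, ℂ), ℂ⟯) (X : GroupLieAlgebra IG G) :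
    ContMDiff IM 𝓘(ℝ, ℂ) ∞
      (fun x : M => (mfderiv IG 𝓘(ℝ, ℂ) (fun g : G => u (g⁻¹ • x)) 1 X : ℂ)) := by
  have hF := contMDiff_inv_smul_comp (IG := IG) (G := G) u
  have h₁ : ContMDiff IM (IG.tangent.prod IM.tangent) ∞ (fun x : M =>
      ((⟨1, X⟩ : TangentBundle IG G), (⟨x, 0⟩ : TangentBundle IM M))) :=
    contMDiff_const.prodMk (Bundle.contMDiff_zeroSection ℝ (TangentSpace IM))
  have h₂ := (contMDiff_equivTangentBundleProd_symm (n := ∞) (I := IG) (M := G) (I' := IM)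
    (M' := M)).comp h₁
  have h₃ := (hF.contMDiff_tangentMap (m := ∞) (by simp)).comp h₂
  have h₄ := (contMDiff_snd_tangentBundle_modelSpace ℂ 𝓘(ℝ, ℂ) (n := ∞)).comp h₃
  refine h₄.congr fun x => ?_
  have hx := mfderiv_prod_eq_add_apply (v := ((X, (0 : TangentSpace IM x)) : TangentSpace (IG.prod IM) ((1 : G), x)))
    ((hF.mdifferentiable (by simp)) ((1 : G), x))
  refine Eq.trans ?_ hx.symm
  simp
  rfl

/-- The infinitesimal action of `X ∈ 𝔤` on `C^∞(M, ℂ)`: the derivative at `g = 1`, in the direction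
`X`, of `(g · u)(x) = u(g⁻¹ x)`, that is `d/dt|_{t = 0} u(exp(-tX) x)`. As the bracket of `𝔤` is
that of left-invariant vector fields and `G` acts from the left, this is the sign for which one
gets a representation of `𝔤`. -/
def infinitesimalRep (IG : ModelWithCorners ℝ EG HG) (G : Type*) [TopologicalSpace G]
    [ChartedSpace HG G] [Group G] [LieGroup IG ∞ G]
    (IM : ModelWithCorners ℝ EM HM) (M : Type*) [TopologicalSpace M] [ChartedSpace HM M]
    [IsManifold IM ∞ M] [MulAction G M] [ContMDiffSMul IG IM ∞ G M] :
    GroupLieAlgebra IG G →ₗ[ℝ] Module.End ℝ C^∞⟮IM, M; 𝓘(ℝ, ℂ), ℂ⟯ :=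
  LinearMap.mk₂ ℝ
    (fun X u => ⟨fun x => (mfderiv IG 𝓘(ℝ, ℂ) (fun g : G => u (g⁻¹ • x)) 1 X : ℂ),
      contMDiff_infinitesimal u X⟩)
    (fun X X' u => by
      ext x
      exact (mfderiv IG 𝓘(ℝ, ℂ) (fun g : G => u (g⁻¹ • x)) 1).map_add X X')
    (fun c X u => by
      ext x
      exact (mfderiv IG 𝓘(ℝ, ℂ) (fun g : G => u (g⁻¹ • x)) 1).map_smul c X)
    (fun X u u' => by
      ext x
      have h := mfderiv_add (mdifferentiableAt_inv_smul_comp (IG := IG) (G := G) u x 1)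
        (mdifferentiableAt_inv_smul_comp (IG := IG) (G := G) u' x 1)
      exact congrArg (fun L => L X) h)
    (fun c X u => by
      ext x
      have h := const_smul_mfderiv (mdifferentiableAt_inv_smul_comp (IG := IG) (G := G) u x 1) c
      exact congrArg (fun L => L X) h)

/-- The inclusion of the constants in `C^∞(M, ℂ)`. -/
def constMap (IM : ModelWithCorners ℝ EM HM) (M : Type*) [TopologicalSpace M] [ChartedSpace HM M] :
    ℂ →ₗ[ℝ] C^∞⟮IM, M; 𝓘(ℝ, ℂ), ℂ⟯ where
  toFun c := ContMDiffMap.const c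
  map_add' _ _ := rfl
  map_smul' _ _ := rfl

/-- The natural map `H¹(𝔤) → H¹(α)`, induced by sending `c : 𝔤 → ℂ` to the cochain `X ↦ c(X) · 1`.
Here `H¹(𝔤)` is the cohomology of `𝔤` with coefficients in the trivial representation on `ℂ`, and
`H¹(α)` is the cohomology of `𝔤` with coefficients in `C^∞(M, ℂ)`. -/
def naturalMapH1 (IG : ModelWithCorners ℝ EG HG) [CompleteSpace EG]
    (G : Type*) [TopologicalSpace G]
    [ChartedSpace HG G] [Group G] [LieGroup IG ∞ G]
    (IM : ModelWithCorners ℝ EM HM) (M : Type*) [TopologicalSpace M] [ChartedSpace HM M]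
    [IsManifold IM ∞ M] [MulAction G M] [ContMDiffSMul IG IM ∞ G M] :
    ChevalleyEilenberg.H1 (0 : GroupLieAlgebra IG G →ₗ[ℝ] Module.End ℝ ℂ) →ₗ[ℝ]
      ChevalleyEilenberg.H1 (infinitesimalRep IG G IM M) :=
  ChevalleyEilenberg.mapH1 (constMap IM M) (by
    intro X c
    ext x
    have h : mfderiv IG 𝓘(ℝ, ℂ) (fun _ : G => c) 1 = 0 := mfderiv_const
    exact (congrArg (fun L => L X) h).symm)

end Action

/-! ### De Rham cohomology in degree one and the first Betti number -/

section DeRham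

variable {E H : Type*} [NormedAddCommGroup E] [NormedSpace ℝ E] [TopologicalSpace H]
  (I : ModelWithCorners ℝ E H) [I.Boundaryless]
  (M : Type*) [TopologicalSpace M] [ChartedSpace H M]

/-- Fields of covectors on `M` (no regularity imposed). -/
def CovectorField : Type _ := ∀ x : M, TangentSpace I x →L[ℝ] ℝ

instance CovectorField.instAddCommGroup : AddCommGroup (CovectorField I M) :=
  inferInstanceAs (AddCommGroup (∀ x : M, TangentSpace I x →L[ℝ] ℝ))

instance CovectorField.instModule : Module ℝ (CovectorField I M) :=
  inferInstanceAs (Module ℝ (∀ x : M, TangentSpace I x →L[ℝ] ℝ))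

variable {I M} in
/-- The coordinate expression of `θ` in the chart at `x₀`, i.e. the pull-back of `θ` under the
inverse of the chart, as a map `E → E*` (meaningful on the target of the chart). -/
def CovectorField.inChart (θ : CovectorField I M) (x₀ : M) (y : E) : E →L[ℝ] ℝ :=
  (θ ((extChartAt I x₀).symm y)).comp (mfderiv 𝓘(ℝ, E) I (extChartAt I x₀).symm y)

/-- The space of closed smooth 1-forms: in each chart the coefficients are smooth and
`dθ(v, w) = (D_v θ)(w) - (D_w θ)(v)` vanishes. -/
def closedOneForms : Submodule ℝ (CovectorField I M) where
  carrier := {θ | ∀ x₀ : M, ContDiffOn ℝ ∞ (θ.inChart x₀) (extChartAt I x₀).target ∧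
    ∀ y ∈ (extChartAt I x₀).target, ∀ v w : E,
      fderiv ℝ (θ.inChart x₀) y v w = fderiv ℝ (θ.inChart x₀) y w v}
  zero_mem' := by
    intro x₀
    have h : CovectorField.inChart (0 : CovectorField I M) x₀ = fun _ => 0 := by
      funext y; exact ContinuousLinearMap.zero_comp _
    rw [h]
    exact ⟨contDiffOn_const, by simp⟩
  add_mem' := by
    intro θ θ' hθ hθ' x₀
    have h : CovectorField.inChart (θ + θ') x₀ = θ.inChart x₀ + θ'.inChart x₀ := by
      funext y; exact ContinuousLinearMap.add_comp _ _ _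
    rw [h]
    refine ⟨(hθ x₀).1.add (hθ' x₀).1, fun y hy v w => ?_⟩
    have hn := (isOpen_extChartAt_target (I := I) x₀).mem_nhds hy
    rw [fderiv_add (((hθ x₀).1.contDiffAt hn).differentiableAt (by simp))
      (((hθ' x₀).1.contDiffAt hn).differentiableAt (by simp))]
    simp [(hθ x₀).2 y hy v w, (hθ' x₀).2 y hy v w]
  smul_mem' := by
    intro c θ hθ x₀
    have h : CovectorField.inChart (c • θ) x₀ = c • θ.inChart x₀ := by
      funext y; exact ContinuousLinearMap.smul_comp _ _ _
    rw [h]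
    refine ⟨contDiffOn_const.smul (hθ x₀).1, fun y hy v w => ?_⟩
    have hn := (isOpen_extChartAt_target (I := I) x₀).mem_nhds hy
    rw [fderiv_const_smul (((hθ x₀).1.contDiffAt hn).differentiableAt (by simp))]
    simp [(hθ x₀).2 y hy v w]

/-- The space of exact 1-forms `df`, `f ∈ C^∞(M, ℝ)`. -/
def exactOneForms : Submodule ℝ (CovectorField I M) where
  carrier := {θ | ∃ f : C^∞⟮I, M; 𝓘(ℝ, ℝ), ℝ⟯, ∀ x, θ x = mfderiv I 𝓘(ℝ, ℝ) f x}
  zero_mem' := ⟨0, fun x => (mfderiv_const (c := (0 : ℝ))).symm⟩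
  add_mem' := by
    rintro θ θ' ⟨f, hf⟩ ⟨f', hf'⟩
    refine ⟨f + f', fun x => ?_⟩
    refine Eq.trans ?_ (mfderiv_add f.mdifferentiableAt f'.mdifferentiableAt).symm
    exact congrArg₂ (· + ·) (hf x) (hf' x)
  smul_mem' := by
    rintro c θ ⟨f, hf⟩
    refine ⟨c • f, fun x => ?_⟩
    refine Eq.trans ?_ (const_smul_mfderiv f.mdifferentiableAt c).symm
    exact congrArg (c • ·) (hf x)

/-- The first de Rham cohomology `H¹(M; ℝ)`: closed 1-forms modulo exact 1-forms. -/
abbrev DeRhamH1 : Type _ :=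
  closedOneForms I M ⧸ (exactOneForms I M).submoduleOf (closedOneForms I M)

/-- The first Betti number `b₁(M) = dim H¹(M; ℝ)`. -/
def firstBetti : ℕ := Module.finrank ℝ (DeRhamH1 I M)

end DeRham

/-! ### The torus -/

/-- The torus `𝕋ᵇ`, a product of `b` circles. -/
abbrev Torus (b : ℕ) : Type := Fin b → Circle

/-- The model with corners of the product manifold `𝕋ᵇ`. -/
abbrev torusModel (b : ℕ) :
    ModelWithCorners ℝ (Fin b → EuclideanSpace ℝ (Fin 1))
      (ModelPi fun _ : Fin b => EuclideanSpace ℝ (Fin 1)) :=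
  ModelWithCorners.pi fun _ : Fin b => 𝓡 1

end

/-! Circle-valued functions carry the argument. For smooth p : M → S¹ the form `dlog p` = -i p⁻¹ dp
is closed, and such forms span H¹(M; ℝ) (`exists_sub_sum_dlog_mem_exactOneForms`): the local
primitives of a closed form on a finite cover differ by finitely many constants, these generate a
free group of finite rank, and each coordinate on that group is an integral Čech cocycle, which a
partition of unity turns into a circle-valued map.

The cochain X ↦ -i p⁻¹(X·p) is a real-valued cocycle, so surjectivity of H¹(𝔤) → H¹(α) makes it a
constant cocycle plus a coboundary X·u. Multiplying p by exp(-i Re u) removes the coboundary and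
changes `dlog p` only by an exact form. The result q satisfies X·q = i a(X) q with a real
(`exists_eigenfunction`), and connectedness of G integrates this to q(gx) = λ(g) q(x)
(`smul_ratio_eq`).

The forms `dlog q` are therefore G-invariant. A real combination of them that vanishes at one point
vanishes on an orbit, hence everywhere by minimality, hence is zero in cohomology
(`eq_zero_of_sum_smul_dlog_eq_zero`). So independent classes have representatives independent at
every point of M. This bounds b₁(M) by dim M, and it makes the map π = (q₁, …, q_b), built from a
basis of classes, a submersion. Its image is open and compact in a connected torus, so π is onto;
the multipliers λ form τ. -/

/-! ### Lie brackets of vector fields as commutators of derivations -/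

open VectorField Topology in
-- In the commutator the two second-derivative terms cancel by symmetry, and the first-order terms
-- left over are the bracket.
theorem fderiv_lieBracket_apply {E F : Type*} [NormedAddCommGroup E] [NormedSpace ℝ E]
    [NormedAddCommGroup F] [NormedSpace ℝ F] {f : E → F} {V W : E → E} {y : E}
    (hf : ContDiffAt ℝ 2 f y) (hV : DifferentiableAt ℝ V y) (hW : DifferentiableAt ℝ W y) :
    fderiv ℝ f y (lieBracket ℝ V W y) =
      fderiv ℝ (fun z => fderiv ℝ f z (W z)) y (V y) -
        fderiv ℝ (fun z => fderiv ℝ f z (V z)) y (W y) := by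
  have hd : DifferentiableAt ℝ (fderiv ℝ f) y :=
    (hf.fderiv_right (m := 1) (by norm_num)).differentiableAt (by norm_num)
  have hs : IsSymmSndFDerivAt ℝ f y := hf.isSymmSndFDerivAt (by simp)
  rw [fderiv_clm_apply hd hW, fderiv_clm_apply hd hV]
  simp [lieBracket, hs.eq (V y) (W y)]

section LieBracket
open VectorField Topology Set
variable {E H : Type*} [NormedAddCommGroup E] [NormedSpace ℝ E] [TopologicalSpace H]
  {I : ModelWithCorners ℝ E H} [I.Boundaryless]
  {M : Type*} [TopologicalSpace M] [ChartedSpace H M]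
  {F : Type*} [NormedAddCommGroup F] [NormedSpace ℝ F]

theorem mfderiv_extChartAt_symm_comp_mfderiv_extChartAt [IsManifold I 1 M] {x₀ x : M}
    (hx : x ∈ (extChartAt I x₀).source) :
    (mfderiv 𝓘(ℝ, E) I (extChartAt I x₀).symm (extChartAt I x₀ x)).comp
      (mfderiv I 𝓘(ℝ, E) (extChartAt I x₀) x) = ContinuousLinearMap.id ℝ (TangentSpace I x) := by
  have h := mfderivWithin_extChartAt_symm_comp_mfderiv_extChartAt' (I := I) hx
  rwa [I.range_eq_univ, mfderivWithin_univ] at h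

theorem mdifferentiableAt_extChartAt_symm [IsManifold I 1 M] {x₀ : M} {y : E}
    (hy : y ∈ (extChartAt I x₀).target) :
    MDifferentiableAt 𝓘(ℝ, E) I (extChartAt I x₀).symm y := by
  have h := mdifferentiableWithinAt_extChartAt_symm (I := I) hy
  rwa [I.range_eq_univ, mdifferentiableWithinAt_univ] at h

theorem mfderiv_eq_fderiv_comp_mfderiv_extChartAt [IsManifold I 1 M] {f : M → F} {x₀ x : M}
    (hx : x ∈ (extChartAt I x₀).source) (hf : MDifferentiableAt I 𝓘(ℝ, F) f x) :
    mfderiv I 𝓘(ℝ, F) f x = (fderiv ℝ (f ∘ (extChartAt I x₀).symm) (extChartAt I x₀ x)).comp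
      (mfderiv I 𝓘(ℝ, E) (extChartAt I x₀) x) := by
  have hy := (extChartAt I x₀).map_source hx
  have e := (extChartAt I x₀).left_inv hx
  have h1 : mfderiv 𝓘(ℝ, E) 𝓘(ℝ, F) (f ∘ (extChartAt I x₀).symm) (extChartAt I x₀ x) =
      (mfderiv I 𝓘(ℝ, F) f x).comp
        (mfderiv 𝓘(ℝ, E) I (extChartAt I x₀).symm (extChartAt I x₀ x)) := by
    rw [mfderiv_comp (I' := I) _ (by rwa [e]) (mdifferentiableAt_extChartAt_symm hy), e]
  rw [← mfderiv_eq_fderiv, h1]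
  have h2 := mfderiv_extChartAt_symm_comp_mfderiv_extChartAt (I := I) hx
  ext v
  have := congrArg (fun L => L v) h2
  exact (congrArg (mfderiv I 𝓘(ℝ, F) f x) this).symm

theorem fderiv_comp_extChartAt_symm [IsManifold I 1 M] {f : M → F} {x₀ : M} {y : E}
    (hy : y ∈ (extChartAt I x₀).target)
    (hf : MDifferentiableAt I 𝓘(ℝ, F) f ((extChartAt I x₀).symm y)) :
    fderiv ℝ (f ∘ (extChartAt I x₀).symm) y =
      (mfderiv I 𝓘(ℝ, F) f ((extChartAt I x₀).symm y)).comp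
        (mfderiv 𝓘(ℝ, E) I (extChartAt I x₀).symm y) := by
  rw [← mfderiv_eq_fderiv, mfderiv_comp (I' := I) _ hf (mdifferentiableAt_extChartAt_symm hy)]

variable (I) in
/-- The derivative `V f` of a function `f` along a vector field `V`. -/
noncomputable def derivAlong (V : ∀ x : M, TangentSpace I x) (f : M → F) (x : M) : F :=
  mfderiv I 𝓘(ℝ, F) f x (V x)

/-- The manifold bracket is by definition transported from the chart at x, so the identity reduces
to `fderiv_lieBracket_apply` for the pulled-back fields and f read in that chart. -/
theorem derivAlong_mlieBracket [CompleteSpace E] [IsManifold I 2 M] {f : M → F}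
    {V W : ∀ x : M, TangentSpace I x} {x : M} (hf : ContMDiff I 𝓘(ℝ, F) 2 f)
    (hV : MDifferentiableAt I I.tangent (fun y => (V y : TangentBundle I M)) x)
    (hW : MDifferentiableAt I I.tangent (fun y => (W y : TangentBundle I M)) x)
    (hVf : MDifferentiableAt I 𝓘(ℝ, F) (derivAlong I V f) x)
    (hWf : MDifferentiableAt I 𝓘(ℝ, F) (derivAlong I W f) x) :
    derivAlong I (mlieBracket I V W) f x =
      derivAlong I V (derivAlong I W f) x - derivAlong I W (derivAlong I V f) x := by
  have : IsManifold I 1 M := IsManifold.of_le (n := 2) (by norm_num)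
  set φ := extChartAt I x with hφ
  have hxs : x ∈ φ.source := mem_extChartAt_source x
  have hxt : φ x ∈ φ.target := mem_extChartAt_target x
  let V' : E → E := mpullbackWithin 𝓘(ℝ, E) I φ.symm V (range I)
  let W' : E → E := mpullbackWithin 𝓘(ℝ, E) I φ.symm W (range I)
  have hset : φ.symm ⁻¹' univ ∩ range I = univ := by rw [I.range_eq_univ]; simp
  have dV : DifferentiableAt ℝ V' (φ x) := by
    have h : DifferentiableWithinAt ℝ V' (φ.symm ⁻¹' univ ∩ range I) (φ x) :=
      MDifferentiableWithinAt.differentiableWithinAt_mpullbackWithin_vectorField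
        (hV.mdifferentiableWithinAt (s := univ))
    rwa [hset, differentiableWithinAt_univ] at h
  have dW : DifferentiableAt ℝ W' (φ x) := by
    have h : DifferentiableWithinAt ℝ W' (φ.symm ⁻¹' univ ∩ range I) (φ x) :=
      MDifferentiableWithinAt.differentiableWithinAt_mpullbackWithin_vectorField
        (hW.mdifferentiableWithinAt (s := univ))
    rwa [hset, differentiableWithinAt_univ] at h
  -- The chart inverse has invertible derivative on its target, so pushing the pulled-back field
  -- forward recovers the field.
  have key : ∀ U : ∀ x : M, TangentSpace I x, ∀ z ∈ φ.target,
      mfderiv 𝓘(ℝ, E) I φ.symm z (mpullbackWithin 𝓘(ℝ, E) I φ.symm U (range I) z) =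
        U (φ.symm z) := by
    intro U z hz
    have hinv := isInvertible_mfderivWithin_extChartAt_symm (I := I) hz
    have := hinv.self_apply_inverse (U (φ.symm z))
    rw [mpullbackWithin]
    rwa [I.range_eq_univ, mfderivWithin_univ] at this ⊢
  have hmd : ∀ z, MDifferentiableAt I 𝓘(ℝ, F) f z := fun z => hf.mdifferentiable (by norm_num) z
  have keyf : ∀ U : ∀ x : M, TangentSpace I x, ∀ z ∈ φ.target,
      (derivAlong I U f ∘ φ.symm) z = fderiv ℝ (f ∘ φ.symm) z
        (mpullbackWithin 𝓘(ℝ, E) I φ.symm U (range I) z) := by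
    intro U z hz
    rw [fderiv_comp_extChartAt_symm hz (hmd _)]
    exact (congrArg (mfderiv I 𝓘(ℝ, F) f (φ.symm z)) (key U z hz)).symm
  have hnhds : φ.target ∈ 𝓝 (φ x) := (isOpen_extChartAt_target x).mem_nhds hxt
  have hfx : ContDiffAt ℝ 2 (f ∘ φ.symm) (φ x) := by
    have h1 : ContMDiffAt 𝓘(ℝ, E) I 2 φ.symm (φ x) :=
      (contMDiffOn_extChartAt_symm x).contMDiffAt hnhds
    exact (hf.contMDiffAt.comp _ h1).contDiffAt
  have main := fderiv_lieBracket_apply hfx dV dW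
  have step : ∀ U U' : ∀ x : M, TangentSpace I x,
      MDifferentiableAt I 𝓘(ℝ, F) (derivAlong I U f) x →
      derivAlong I U' (derivAlong I U f) x = fderiv ℝ (fun z => fderiv ℝ (f ∘ φ.symm) z
        (mpullbackWithin 𝓘(ℝ, E) I φ.symm U (range I) z)) (φ x)
        (mpullbackWithin 𝓘(ℝ, E) I φ.symm U' (range I) (φ x)) := by
    intro U U' hU
    have e : φ.symm (φ x) = x := φ.left_inv hxs
    have h1 : (fun z => fderiv ℝ (f ∘ φ.symm) z
        (mpullbackWithin 𝓘(ℝ, E) I φ.symm U (range I) z)) =ᶠ[𝓝 (φ x)]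
        (derivAlong I U f ∘ φ.symm) := by
      filter_upwards [hnhds] with z hz using (keyf U z hz).symm
    rw [h1.fderiv_eq, fderiv_comp_extChartAt_symm hxt (by rwa [e])]
    refine Eq.trans ?_ (congrArg (mfderiv I 𝓘(ℝ, F) (derivAlong I U f) (φ.symm (φ x)))
      (key U' (φ x) hxt)).symm
    rw [e]; rfl
  rw [step W V hWf, step V W hVf]
  refine Eq.trans ?_ main
  rw [derivAlong, mfderiv_eq_fderiv_comp_mfderiv_extChartAt hxs (hmd x)]
  have hb : mfderiv I 𝓘(ℝ, E) φ x (mlieBracket I V W x) = lieBracket ℝ V' W' (φ x) := by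
    have hinv := isInvertible_mfderiv_extChartAt (I := I) hxs
    have h2 : mfderiv I 𝓘(ℝ, E) φ x (mlieBracket I V W x) =
        lieBracketWithin ℝ V' W' (φ.symm ⁻¹' univ ∩ range I) (φ x) := hinv.self_apply_inverse _
    have h3 : lieBracketWithin ℝ V' W' (φ.symm ⁻¹' univ ∩ range I) (φ x) =
        lieBracket ℝ V' W' (φ x) := by rw [hset, lieBracketWithin_univ]
    exact h2.trans h3
  exact congrArg (fderiv ℝ (f ∘ φ.symm) (φ x)) hb

end LieBracket

theorem two_le_infty : (2 : WithTop ℕ∞) ≤ ∞ := WithTop.coe_le_coe.2 le_top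

/-! ### Functions with vanishing derivative -/

section LocallyConstant
open Topology Set
variable {E H : Type*} [NormedAddCommGroup E] [NormedSpace ℝ E] [TopologicalSpace H]
  {I : ModelWithCorners ℝ E H} [I.Boundaryless]
  {M : Type*} [TopologicalSpace M] [ChartedSpace H M] [IsManifold I 1 M]
  {F : Type*} [NormedAddCommGroup F] [NormedSpace ℝ F]

/-- A small ball in a chart is connected. The hypothesis is local so that differences of locally
defined primitives are covered. -/
theorem eventually_eq_of_mfderiv_eq_zero {f : M → F} {x : M}
    (h : ∀ᶠ y in 𝓝 x, MDifferentiableAt I 𝓘(ℝ, F) f y ∧ mfderiv I 𝓘(ℝ, F) f y = 0) :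
    ∀ᶠ y in 𝓝 x, f y = f x := by
  set φ := extChartAt I x with hφ
  have e : φ.symm (φ x) = x := φ.left_inv (mem_extChartAt_source x)
  have hc : Filter.Tendsto φ.symm (𝓝 (φ x)) (𝓝 x) := by
    have := (continuousAt_extChartAt_symm (I := I) x).tendsto
    rwa [e] at this
  have h2 : ∀ᶠ z in 𝓝 (φ x), z ∈ φ.target ∧ MDifferentiableAt I 𝓘(ℝ, F) f (φ.symm z) ∧
      mfderiv I 𝓘(ℝ, F) f (φ.symm z) = 0 :=
    Filter.Eventually.and ((isOpen_extChartAt_target x).mem_nhds (mem_extChartAt_target x))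
      (hc.eventually h)
  obtain ⟨r, hr, hball⟩ := Metric.eventually_nhds_iff_ball.1 h2
  have hconst : ∀ z ∈ Metric.ball (φ x) r, (f ∘ φ.symm) z = (f ∘ φ.symm) (φ x) := by
    intro z hz
    refine Metric.isOpen_ball.is_const_of_fderiv_eq_zero (𝕜 := ℝ)
      (convex_ball (φ x) r).isPreconnected ?_ ?_ hz (Metric.mem_ball_self hr)
    · intro w hw
      obtain ⟨hw1, hw2, -⟩ := hball w hw
      have hd := hw2.comp w (mdifferentiableAt_extChartAt_symm hw1)
      exact hd.differentiableAt.differentiableWithinAt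
    · intro w hw
      obtain ⟨hw1, hw2, hw3⟩ := hball w hw
      rw [fderiv_comp_extChartAt_symm hw1 hw2, hw3]
      exact ContinuousLinearMap.zero_comp _
  filter_upwards
    [(continuousAt_extChartAt (I := I) x).preimage_mem_nhds (Metric.ball_mem_nhds _ hr),
    extChartAt_source_mem_nhds (I := I) x] with y hy hys
  have := hconst (φ y) hy
  simpa [e, φ.left_inv hys] using this

theorem eq_of_mfderiv_eq_zero [PreconnectedSpace M] {f : M → F}
    (hf : MDifferentiable I 𝓘(ℝ, F) f) (h : ∀ y, mfderiv I 𝓘(ℝ, F) f y = 0) (x y : M) :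
    f x = f y :=
  IsLocallyConstant.apply_eq_of_preconnectedSpace
    ((IsLocallyConstant.iff_eventually_eq f).2 fun _ =>
      eventually_eq_of_mfderiv_eq_zero (Filter.Eventually.of_forall fun y => ⟨hf y, h y⟩)) x y

end LocallyConstant

/-! ### Products and compositions of smooth complex functions -/

section ComplexSmooth
variable {E H : Type*} [NormedAddCommGroup E] [NormedSpace ℝ E] [TopologicalSpace H]
  {I : ModelWithCorners ℝ E H} {M : Type*} [TopologicalSpace M] [ChartedSpace H M]

/-- The pointwise product of smooth complex functions. -/
noncomputable def ContMDiffMap.mulComplex (u v : C^∞⟮I, M; 𝓘(ℝ, ℂ), ℂ⟯) : C^∞⟮I, M; 𝓘(ℝ, ℂ), ℂ⟯ :=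
  ⟨fun x => u x * v x, (contDiff_mul (𝔸 := ℂ)).contMDiff.comp
    (u.contMDiff.prodMk_space v.contMDiff)⟩

/-- The composition of a smooth complex function with a real-smooth self-map of `ℂ`. -/
noncomputable def ContMDiffMap.postComplex (φ : ℂ → ℂ) (hφ : ContDiff ℝ ∞ φ)
    (u : C^∞⟮I, M; 𝓘(ℝ, ℂ), ℂ⟯) :
    C^∞⟮I, M; 𝓘(ℝ, ℂ), ℂ⟯ :=
  ⟨fun x => φ (u x), hφ.contMDiff.comp u.contMDiff⟩

@[simp] theorem ContMDiffMap.mulComplex_apply (u v : C^∞⟮I, M; 𝓘(ℝ, ℂ), ℂ⟯) (x : M) :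
    u.mulComplex v x = u x * v x := rfl

@[simp] theorem ContMDiffMap.postComplex_apply (φ : ℂ → ℂ) (hφ : ContDiff ℝ ∞ φ)
    (u : C^∞⟮I, M; 𝓘(ℝ, ℂ), ℂ⟯) (x : M) : u.postComplex φ hφ x = φ (u x) := rfl

theorem mfderiv_mul_complex_apply {p q : M → ℂ} {x : M} (hp : MDifferentiableAt I 𝓘(ℝ, ℂ) p x)
    (hq : MDifferentiableAt I 𝓘(ℝ, ℂ) q x) (v : TangentSpace I x) :
    (mfderiv I 𝓘(ℝ, ℂ) (fun y => p y * q y) x v : ℂ) =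
      p x * (show ℂ from mfderiv I 𝓘(ℝ, ℂ) q x v) +
        q x * (show ℂ from mfderiv I 𝓘(ℝ, ℂ) p x v) := by
  have h := (hp.hasMFDerivAt.mul hq.hasMFDerivAt).mfderiv
  exact congrArg (fun L => L v) h

theorem mfderiv_post_apply {F F' : Type*} [NormedAddCommGroup F] [NormedSpace ℝ F]
    [NormedAddCommGroup F'] [NormedSpace ℝ F'] {p : M → F} {x : M}
    (hp : MDifferentiableAt I 𝓘(ℝ, F) p x) {φ : F → F'} (hφ : DifferentiableAt ℝ φ (p x))
    (v : TangentSpace I x) :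
    (mfderiv I 𝓘(ℝ, F') (fun y => φ (p y)) x v : F') =
      fderiv ℝ φ (p x) (mfderiv I 𝓘(ℝ, F) p x v) := by
  have := mfderiv_comp_apply (I' := 𝓘(ℝ, F)) x hφ.mdifferentiableAt hp v
  rw [mfderiv_eq_fderiv] at this
  exact this

end ComplexSmooth

/-! ### The infinitesimal action as a representation by derivations -/

section Representation
open VectorField
variable {EG HG : Type*} [NormedAddCommGroup EG] [NormedSpace ℝ EG]
  [TopologicalSpace HG] {IG : ModelWithCorners ℝ EG HG}
  {G : Type*} [TopologicalSpace G] [ChartedSpace HG G] [Group G]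
  {EM HM : Type*} [NormedAddCommGroup EM] [NormedSpace ℝ EM] [TopologicalSpace HM]
  {IM : ModelWithCorners ℝ EM HM} {M : Type*} [TopologicalSpace M] [ChartedSpace HM M]
  [IsManifold IM ∞ M] [LieGroup IG ∞ G] [MulAction G M] [ContMDiffSMul IG IM ∞ G M]

theorem infinitesimalRep_mul (X : GroupLieAlgebra IG G) (u v : C^∞⟮IM, M; 𝓘(ℝ, ℂ), ℂ⟯) (x : M) :
    infinitesimalRep IG G IM M X (u.mulComplex v) x =
      u x * infinitesimalRep IG G IM M X v x + v x * infinitesimalRep IG G IM M X u x := by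
  have h := mfderiv_mul_complex_apply (mdifferentiableAt_inv_smul_comp (IG := IG) (G := G) u x 1)
    (mdifferentiableAt_inv_smul_comp (IG := IG) (G := G) v x 1) X
  simp only [inv_one, one_smul] at h
  exact h

theorem infinitesimalRep_post (X : GroupLieAlgebra IG G) (φ : ℂ → ℂ) (hφ : ContDiff ℝ ∞ φ)
    (u : C^∞⟮IM, M; 𝓘(ℝ, ℂ), ℂ⟯) (x : M) :
    infinitesimalRep IG G IM M X (u.postComplex φ hφ) x =
      fderiv ℝ φ (u x) (infinitesimalRep IG G IM M X u x) := by
  have h := mfderiv_post_apply (mdifferentiableAt_inv_smul_comp (IG := IG) (G := G) u x 1)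
    (φ := φ) (hφ.differentiable (by simp) _) X
  simp only [inv_one, one_smul] at h
  exact h

/-- Since u((gh)⁻¹x) = u(h⁻¹(g⁻¹x)), the derivative at g along a left-invariant field is a
derivative at 1 with x replaced by g⁻¹x. Iterated derivatives on G thus become iterated actions on
M. -/
theorem derivAlong_mulInvariantVectorField_orbit [IG.Boundaryless] (X : GroupLieAlgebra IG G)
    (u : C^∞⟮IM, M; 𝓘(ℝ, ℂ), ℂ⟯) (x : M) :
    derivAlong IG (mulInvariantVectorField X) (fun g : G => u (g⁻¹ • x)) =
      fun g : G => infinitesimalRep IG G IM M X u (g⁻¹ • x) := by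
  funext g
  have hmul : MDifferentiableAt IG IG (fun h : G => g * h) 1 :=
    (contMDiff_mul_left (I := IG) (n := ∞)).mdifferentiable (by simp) 1
  have h := mfderiv_comp_apply_of_eq (I' := IG) (1 : G) (f := fun h : G => g * h) (y := g)
    (mdifferentiableAt_inv_smul_comp (IG := IG) (G := G) u x g) hmul (mul_one g) X
  have e : (fun g : G => u (g⁻¹ • x)) ∘ (fun h : G => g * h) =
      fun h : G => u (h⁻¹ • g⁻¹ • x) := by
    funext h; simp [mul_smul]
  rw [e] at h
  exact h.symm

theorem infinitesimalRep_lie [IG.Boundaryless] [CompleteSpace EG] (X Y : GroupLieAlgebra IG G)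
    (u : C^∞⟮IM, M; 𝓘(ℝ, ℂ), ℂ⟯) (x : M) :
    infinitesimalRep IG G IM M ⁅X, Y⁆ u x =
      infinitesimalRep IG G IM M X (infinitesimalRep IG G IM M Y u) x -
        infinitesimalRep IG G IM M Y (infinitesimalRep IG G IM M X u) x := by
  have : IsManifold IG ∞ G := inferInstance
  have : IsManifold IG 2 G := IsManifold.of_le (n := ∞) two_le_infty
  have hu : ContMDiff IG 𝓘(ℝ, ℂ) ∞ (fun g : G => u (g⁻¹ • x)) :=
    (contMDiff_inv_smul_comp (IG := IG) (G := G) u).comp (contMDiff_id.prodMk contMDiff_const)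
  have hd : ∀ Z : GroupLieAlgebra IG G, MDifferentiableAt IG 𝓘(ℝ, ℂ)
      (derivAlong IG (mulInvariantVectorField Z) (fun g : G => u (g⁻¹ • x))) 1 := fun Z => by
    rw [derivAlong_mulInvariantVectorField_orbit]
    exact mdifferentiableAt_inv_smul_comp _ x 1
  have main := derivAlong_mlieBracket (x := (1 : G)) (hu.of_le two_le_infty)
    (mdifferentiableAt_mulInvariantVectorField X) (mdifferentiableAt_mulInvariantVectorField Y)
    (hd X) (hd Y)
  simp only [derivAlong_mulInvariantVectorField_orbit] at main
  simp only [inv_one, one_smul] at main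
  exact main

end Representation

/-! ### From cocycles to eigenfunctions of the action -/

section UnitPhase
variable {E H : Type*} [NormedAddCommGroup E] [NormedSpace ℝ E] [TopologicalSpace H]
  {I : ModelWithCorners ℝ E H} {M : Type*} [TopologicalSpace M] [ChartedSpace H M]

/-- `x ↦ exp(-i Re u(x))`. -/
noncomputable def ContMDiffMap.unitPhase (u : C^∞⟮I, M; 𝓘(ℝ, ℂ), ℂ⟯) : C^∞⟮I, M; 𝓘(ℝ, ℂ), ℂ⟯ :=
  u.postComplex (fun z => Complex.exp (-Complex.I * (Complex.ofRealCLM (Complex.reCLM z))))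
    ((contDiff_const.mul (Complex.ofRealCLM.contDiff.comp Complex.reCLM.contDiff)).cexp)

theorem ContMDiffMap.unitPhase_apply (u : C^∞⟮I, M; 𝓘(ℝ, ℂ), ℂ⟯) (x : M) :
    u.unitPhase x = Complex.exp (-Complex.I * (u x).re) := rfl

end UnitPhase

section Eigenfunction
open ChevalleyEilenberg ComplexConjugate
variable {EG HG : Type*} [NormedAddCommGroup EG] [NormedSpace ℝ EG]
  [TopologicalSpace HG] {IG : ModelWithCorners ℝ EG HG}
  {G : Type*} [TopologicalSpace G] [ChartedSpace HG G] [Group G]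
  {EM HM : Type*} [NormedAddCommGroup EM] [NormedSpace ℝ EM] [TopologicalSpace HM]
  {IM : ModelWithCorners ℝ EM HM} {M : Type*} [TopologicalSpace M] [ChartedSpace HM M]
  [IsManifold IM ∞ M] [LieGroup IG ∞ G] [MulAction G M] [ContMDiffSMul IG IM ∞ G M]

theorem contDiff_conj : ContDiff ℝ ∞ (conj : ℂ → ℂ) := Complex.conjCLE.contDiff

theorem infinitesimalRep_conj (X : GroupLieAlgebra IG G) (u : C^∞⟮IM, M; 𝓘(ℝ, ℂ), ℂ⟯) (x : M) :
    infinitesimalRep IG G IM M X (u.postComplex conj contDiff_conj) x =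
      conj (infinitesimalRep IG G IM M X u x) := by
  rw [infinitesimalRep_post]
  have : fderiv ℝ (conj : ℂ → ℂ) (u x) = Complex.conjCLE.toContinuousLinearMap :=
    Complex.conjCLE.hasFDerivAt.fderiv
  rw [this]; rfl

theorem infinitesimalRep_const (X : GroupLieAlgebra IG G) (u : C^∞⟮IM, M; 𝓘(ℝ, ℂ), ℂ⟯) (c : ℂ)
    (hu : ∀ x, u x = c) (x : M) : infinitesimalRep IG G IM M X u x = 0 := by
  have h : mfderiv IG 𝓘(ℝ, ℂ) (fun _ : G => c) 1 = 0 := mfderiv_const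
  obtain rfl : u = ContMDiffMap.const c := by ext y; exact hu y
  exact congrArg (fun L => L X) h

theorem infinitesimalRep_unitPhase (X : GroupLieAlgebra IG G) (u : C^∞⟮IM, M; 𝓘(ℝ, ℂ), ℂ⟯)
    (x : M) : infinitesimalRep IG G IM M X u.unitPhase x =
      -Complex.I * (infinitesimalRep IG G IM M X u x).re * u.unitPhase x := by
  rw [ContMDiffMap.unitPhase, infinitesimalRep_post]
  have h : HasFDerivAt (fun z : ℂ => Complex.exp (-Complex.I * (Complex.ofRealCLM
      (Complex.reCLM z)))) _ (u x) :=
    ((Complex.ofRealCLM.hasFDerivAt.comp (u x) Complex.reCLM.hasFDerivAt).const_mul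
      (-Complex.I)).cexp
  rw [h.fderiv]
  simp
  ring

/-- The logarithmic derivative `X ↦ -i p⁻¹ (X p)` of a function `p` with values in the unit
circle. -/
noncomputable def logCochain (IG : ModelWithCorners ℝ EG HG) (G : Type*) [TopologicalSpace G]
    [ChartedSpace HG G] [Group G] [LieGroup IG ∞ G] [MulAction G M] [ContMDiffSMul IG IM ∞ G M]
    (p : C^∞⟮IM, M; 𝓘(ℝ, ℂ), ℂ⟯) :
    GroupLieAlgebra IG G →ₗ[ℝ] C^∞⟮IM, M; 𝓘(ℝ, ℂ), ℂ⟯ where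
  toFun X := ((ContMDiffMap.const (-Complex.I)).mulComplex
    (p.postComplex conj contDiff_conj)).mulComplex (infinitesimalRep IG G IM M X p)
  map_add' X Y := by
    ext x
    simp [mul_add]
  map_smul' c X := by
    ext x
    simp
    ring

theorem logCochain_apply (p : C^∞⟮IM, M; 𝓘(ℝ, ℂ), ℂ⟯) (X : GroupLieAlgebra IG G) (x : M) :
    logCochain IG G p X x = -Complex.I * conj (p x) * infinitesimalRep IG G IM M X p x := rfl

theorem conj_mul_infinitesimalRep_add {p : C^∞⟮IM, M; 𝓘(ℝ, ℂ), ℂ⟯}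
    (hp : ∀ x, p x * conj (p x) = 1) (X : GroupLieAlgebra IG G) (x : M) :
    p x * conj (infinitesimalRep IG G IM M X p x) +
      conj (p x) * infinitesimalRep IG G IM M X p x = 0 := by
  have h1 := infinitesimalRep_mul X p (p.postComplex conj contDiff_conj) x
  rw [infinitesimalRep_conj, infinitesimalRep_const X _ 1 (fun y => hp y)] at h1
  exact h1.symm

/-- Differentiating p p̄ = 1 shows that p̄(X·p) is purely imaginary. -/
theorem logCochain_im_eq_zero {p : C^∞⟮IM, M; 𝓘(ℝ, ℂ), ℂ⟯}
    (hp : ∀ x, p x * conj (p x) = 1) (X : GroupLieAlgebra IG G) (x : M) :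
    (logCochain IG G p X x).im = 0 := by
  have h := congrArg Complex.re (conj_mul_infinitesimalRep_add hp X x)
  rw [logCochain_apply]
  simp at h ⊢
  linarith

/-- The terms with second derivatives of p cancel against the bracket term; what remains is
antisymmetric in the products of first derivatives. -/
theorem logCochain_mem_Z1 [IG.Boundaryless] [CompleteSpace EG] {p : C^∞⟮IM, M; 𝓘(ℝ, ℂ), ℂ⟯}
    (hp : ∀ x, p x * conj (p x) = 1) :
    logCochain IG G p ∈ Z1 (infinitesimalRep IG G IM M) := by
  change d₁ _ _ = 0
  ext X Y x
  have hd : ∀ X Y : GroupLieAlgebra IG G,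
      infinitesimalRep IG G IM M X (logCochain IG G p Y) x =
        -Complex.I * (conj (p x) * infinitesimalRep IG G IM M X (infinitesimalRep IG G IM M Y p) x
          + infinitesimalRep IG G IM M Y p x * conj (infinitesimalRep IG G IM M X p x)) := by
    intro X Y
    have h1 := infinitesimalRep_mul X ((ContMDiffMap.const (-Complex.I)).mulComplex
      (p.postComplex conj contDiff_conj)) (infinitesimalRep IG G IM M Y p) x
    have h2 := infinitesimalRep_mul X (ContMDiffMap.const (-Complex.I))
      (p.postComplex conj contDiff_conj) x
    rw [infinitesimalRep_conj, infinitesimalRep_const X (ContMDiffMap.const (-Complex.I))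
      (-Complex.I) (fun y => rfl)] at h2
    rw [h2] at h1
    refine h1.trans ?_
    simp only [ContMDiffMap.mulComplex_apply, ContMDiffMap.postComplex_apply]
    change -Complex.I * _ * _ + _ * (-Complex.I * _ + _) = _
    ring
  have hX := conj_mul_infinitesimalRep_add hp X x
  have hY := conj_mul_infinitesimalRep_add hp Y x
  change infinitesimalRep IG G IM M X (logCochain IG G p Y) x
    - infinitesimalRep IG G IM M Y (logCochain IG G p X) x - logCochain IG G p ⁅X, Y⁆ x = 0
  rw [hd, hd, logCochain_apply, infinitesimalRep_lie]
  have hpx := hp x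
  set a := infinitesimalRep IG G IM M X p x
  set b := infinitesimalRep IG G IM M Y p x
  -- Both p̄a and p̄b are imaginary and |p| = 1, so b ā is real and equals its conjugate.
  have hab : b * conj a = a * conj b := by
    have h1 : conj a = -(conj (p x) * conj (p x) * a) := by
      linear_combination conj (p x) * hX - conj a * hpx
    have h2 : conj b = -(conj (p x) * conj (p x) * b) := by
      linear_combination conj (p x) * hY - conj b * hpx
    rw [h1, h2]; ring
  linear_combination (-Complex.I) * hab

/-- Surjectivity writes the logarithmic cochain as c(X) + X·u. The phase exp(-i Re u) subtracts
Re(X·u) from the logarithmic derivative, and since the cochain is real exactly Re c(X) is left. -/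
theorem exists_eigenfunction [IG.Boundaryless] [CompleteSpace EG] {p : C^∞⟮IM, M; 𝓘(ℝ, ℂ), ℂ⟯}
    (hp : ∀ x, p x * conj (p x) = 1) (hH : Function.Surjective (naturalMapH1 IG G IM M)) :
    ∃ (u : C^∞⟮IM, M; 𝓘(ℝ, ℂ), ℂ⟯) (a : GroupLieAlgebra IG G → ℝ), ∀ X x,
      infinitesimalRep IG G IM M X (p.mulComplex u.unitPhase) x =
        Complex.I * a X * (p.mulComplex u.unitPhase) x := by
  obtain ⟨c, hc⟩ := hH (Submodule.Quotient.mk ⟨logCochain IG G p, logCochain_mem_Z1 hp⟩)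
  obtain ⟨c, rfl⟩ := Submodule.Quotient.mk_surjective _ c
  have h := (Submodule.Quotient.eq _).1 hc.symm
  obtain ⟨u, hu⟩ : logCochain IG G p - (mapZ1 (constMap IM M) _ c).1 ∈
    B1 (infinitesimalRep IG G IM M) := h
  refine ⟨u, fun X => (c.1 X).re, fun X x => ?_⟩
  have hux : infinitesimalRep IG G IM M X u x = logCochain IG G p X x - c.1 X :=
    congrArg (fun f : GroupLieAlgebra IG G →ₗ[ℝ] C^∞⟮IM, M; 𝓘(ℝ, ℂ), ℂ⟯ => f X x) hu
  have him := logCochain_im_eq_zero hp X x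
  have hre : ((infinitesimalRep IG G IM M X u x).re : ℂ) =
      logCochain IG G p X x - ((c.1 X).re : ℂ) := by
    rw [hux]
    apply Complex.ext <;> simp [him]
  rw [infinitesimalRep_mul, infinitesimalRep_unitPhase, hre, logCochain_apply,
    ContMDiffMap.mulComplex_apply]
  linear_combination (-(infinitesimalRep IG G IM M X p x) * u.unitPhase x) * hp x +
    (p x * conj (p x) * infinitesimalRep IG G IM M X p x * u.unitPhase x) * Complex.I_mul_I

/-- The function h ↦ p(h⁻¹x) p̄(h⁻¹y) has zero derivative: the eigenvalue i a(X) cancels against its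
conjugate because a is real. It is then constant on the connected group G. -/
theorem smul_ratio_eq [IG.Boundaryless] [PreconnectedSpace G] {p : C^∞⟮IM, M; 𝓘(ℝ, ℂ), ℂ⟯}
    (hp : ∀ x, p x * conj (p x) = 1) {a : GroupLieAlgebra IG G → ℝ}
    (ha : ∀ X x, infinitesimalRep IG G IM M X p x = Complex.I * a X * p x) (g : G) (x y : M) :
    p (g • x) * conj (p x) = p (g • y) * conj (p y) := by
  have : IsManifold IG ∞ G := inferInstance
  have : IsManifold IG 1 G := IsManifold.of_le (n := ∞) (one_le_two.trans two_le_infty)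
  let R : M → M → G → ℂ := fun x y h => p (h⁻¹ • x) * (p.postComplex conj contDiff_conj) (h⁻¹ • y)
  have hR : ∀ x y, MDifferentiable IG 𝓘(ℝ, ℂ) (R x y) := fun x y h =>
    (mdifferentiableAt_inv_smul_comp p x h).mul (mdifferentiableAt_inv_smul_comp _ y h)
  have h1 : ∀ x y, mfderiv IG 𝓘(ℝ, ℂ) (R x y) 1 = 0 := by
    intro x y
    ext X
    have h := mfderiv_mul_complex_apply (mdifferentiableAt_inv_smul_comp (IG := IG) (G := G) p x 1)
      (mdifferentiableAt_inv_smul_comp (IG := IG) (G := G)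
        (p.postComplex conj contDiff_conj) y 1) X
    refine h.trans ?_
    change _ * infinitesimalRep IG G IM M X (p.postComplex conj contDiff_conj) y +
      _ * infinitesimalRep IG G IM M X p x = 0
    rw [infinitesimalRep_conj, ha, ha]
    simp
    ring
  have hg : ∀ h, mfderiv IG 𝓘(ℝ, ℂ) (R x y) h = 0 := by
    intro h
    -- Left translation moves the derivative at h to the derivative at 1, for the translated pair of
    -- points.
    have e : R x y = R (h⁻¹ • x) (h⁻¹ • y) ∘ (fun k => h⁻¹ * k) := by
      funext k
      simp [R, ← mul_smul]
    have hmul : MDifferentiableAt IG IG (fun k : G => h⁻¹ * k) h :=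
      (contMDiff_mul_left (I := IG) (n := ∞)).mdifferentiable (by simp) h
    ext v
    rw [e, mfderiv_comp_apply_of_eq (I' := IG) h (hR _ _ _) hmul (inv_mul_cancel h) v, h1]
    rfl
  -- Comparing the values at g⁻¹ and at 1 gives p(gx) p̄(gy) = p(x) p̄(y).
  have hc := eq_of_mfderiv_eq_zero (hR x y) hg g⁻¹ 1
  simp [R] at hc
  linear_combination (p (g • y) * conj (p x)) * hc + (p (g • y) * conj (p y)) * hp x -
    (p (g • x) * conj (p x)) * hp (g • y)

end Eigenfunction

/-! ### Closed 1-forms and their local primitives -/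

section Primitive
open Topology Set
variable {E H : Type*} [NormedAddCommGroup E] [NormedSpace ℝ E] [TopologicalSpace H]
  {I : ModelWithCorners ℝ E H}
  {M : Type*} [TopologicalSpace M] [ChartedSpace H M]

/-- `f` is a smooth primitive of the covector field `θ` on the open set `U`. -/
structure IsPrimitiveOn (θ : CovectorField I M) (f : M → ℝ) (U : Set M) : Prop where
  isOpen : IsOpen U
  contMDiffOn : ContMDiffOn I 𝓘(ℝ, ℝ) ∞ f U
  eq_mfderiv : ∀ y ∈ U, θ y = mfderiv I 𝓘(ℝ, ℝ) f y

theorem IsPrimitiveOn.contMDiffAt {θ : CovectorField I M} {f : M → ℝ} {U : Set M}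
    (h : IsPrimitiveOn θ f U) {y : M} (hy : y ∈ U) : ContMDiffAt I 𝓘(ℝ, ℝ) ∞ f y :=
  h.contMDiffOn.contMDiffAt (h.isOpen.mem_nhds hy)

theorem IsPrimitiveOn.mdifferentiableAt {θ : CovectorField I M} {f : M → ℝ} {U : Set M}
    (h : IsPrimitiveOn θ f U) {y : M} (hy : y ∈ U) : MDifferentiableAt I 𝓘(ℝ, ℝ) f y :=
  (h.contMDiffAt hy).mdifferentiableAt (by simp)

variable [I.Boundaryless] [IsManifold I ∞ M]

theorem contMDiffAt_extChartAt_symm {x₀ : M} {y : E} (hy : y ∈ (extChartAt I x₀).target) :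
    ContMDiffAt 𝓘(ℝ, E) I ∞ (extChartAt I x₀).symm y :=
  (contMDiffOn_extChartAt_symm x₀).contMDiffAt ((isOpen_extChartAt_target x₀).mem_nhds hy)

/-- In a chart the form is locally the derivative of a smooth function, and closedness is the
symmetry of its second derivative. -/
theorem mem_closedOneForms_of_exists_primitive {θ : CovectorField I M}
    (h : ∀ x, ∃ f U, x ∈ U ∧ IsPrimitiveOn θ f U) : θ ∈ closedOneForms I M := by
  have : IsManifold I 1 M := IsManifold.of_le (n := ∞) (one_le_two.trans two_le_infty)
  intro x₀
  have key : ∀ y ∈ (extChartAt I x₀).target, ∃ F : E → ℝ, ContDiffAt ℝ ∞ F y ∧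
      θ.inChart x₀ =ᶠ[𝓝 y] fderiv ℝ F := by
    intro y hy
    obtain ⟨f, U, hxU, hf⟩ := h ((extChartAt I x₀).symm y)
    refine ⟨f ∘ (extChartAt I x₀).symm, ?_, ?_⟩
    · exact ((hf.contMDiffAt hxU).comp y (contMDiffAt_extChartAt_symm hy)).contDiffAt
    · have hc := (contMDiffAt_extChartAt_symm (I := I) hy).continuousAt
      filter_upwards [hc.preimage_mem_nhds (hf.isOpen.mem_nhds hxU),
        (isOpen_extChartAt_target x₀).mem_nhds hy] with z hz hzt
      rw [fderiv_comp_extChartAt_symm hzt (hf.mdifferentiableAt hz), CovectorField.inChart,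
        hf.eq_mfderiv _ hz]
      rfl
  refine ⟨fun y hy => ?_, fun y hy v w => ?_⟩
  · obtain ⟨F, hF, he⟩ := key y hy
    exact ((hF.fderiv_right (m := ∞) (by simp)).congr_of_eventuallyEq he).contDiffWithinAt
  · obtain ⟨F, hF, he⟩ := key y hy
    rw [he.fderiv_eq]
    exact (hF.isSymmSndFDerivAt (by simp [two_le_infty])).eq v w

theorem CovectorField.eq_inChart_comp (θ : CovectorField I M) {x₀ z : M}
    (hz : z ∈ (extChartAt I x₀).source) :
    θ z = (θ.inChart x₀ (extChartAt I x₀ z)).comp (mfderiv I 𝓘(ℝ, E) (extChartAt I x₀) z) := by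
  have : IsManifold I 1 M := IsManifold.of_le (n := ∞) (one_le_two.trans two_le_infty)
  have h := mfderiv_extChartAt_symm_comp_mfderiv_extChartAt (I := I) hz
  have e := (extChartAt I x₀).left_inv hz
  ext v
  have hv := congrArg (fun L => L v) h
  refine Eq.trans ?_ (congrArg (θ ((extChartAt I x₀).symm (extChartAt I x₀ z))) hv).symm
  exact congrArg (fun z' => (show E →L[ℝ] ℝ from θ z') v) e.symm

/-- This is the Poincaré lemma on a convex ball in a chart. -/
theorem exists_isPrimitiveOn {θ : CovectorField I M} (hθ : θ ∈ closedOneForms I M) (x : M) :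
    ∃ f U, x ∈ U ∧ IsPrimitiveOn θ f U := by
  have : IsManifold I 1 M := IsManifold.of_le (n := ∞) (one_le_two.trans two_le_infty)
  obtain ⟨hs, hc⟩ := hθ x
  obtain ⟨r, hr, hball⟩ := Metric.isOpen_iff.1 (isOpen_extChartAt_target (I := I) x) _
    (mem_extChartAt_target x)
  set φ := extChartAt I x with hφ
  have hsb := hs.mono hball
  obtain ⟨F, hF⟩ := (convex_ball (φ x) r).exists_forall_hasFDerivAt_of_fderiv_symmetric
    Metric.isOpen_ball (hsb.differentiableOn (by simp)) (fun a ha v w => hc a (hball ha) v w)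
  have hFs : ContDiffOn ℝ ∞ F (Metric.ball (φ x) r) := by
    refine (contDiffOn_infty_iff_fderiv_of_isOpen Metric.isOpen_ball).2
      ⟨fun a ha => (hF a ha).differentiableAt.differentiableWithinAt, ?_⟩
    exact hsb.congr fun a ha => (hF a ha).fderiv
  refine ⟨F ∘ φ, φ.source ∩ φ ⁻¹' Metric.ball (φ x) r,
    ⟨mem_extChartAt_source x, Metric.mem_ball_self hr⟩, ?_, ?_, ?_⟩
  · exact (continuousOn_extChartAt x).isOpen_inter_preimage (isOpen_extChartAt_source x)
      Metric.isOpen_ball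
  · refine hFs.contMDiffOn.comp (t := Metric.ball (φ x) r) ?_ (fun y hy => hy.2)
    have h1 : ContMDiffOn I 𝓘(ℝ, E) ∞ φ φ.source := by
      rw [hφ, extChartAt_source]; exact contMDiffOn_extChartAt
    exact h1.mono inter_subset_left
  · intro y hy
    rw [mfderiv_comp (I' := 𝓘(ℝ, E)) y (hF _ hy.2).differentiableAt.mdifferentiableAt
      (mdifferentiableAt_extChartAt (by simpa [hφ] using hy.1)), mfderiv_eq_fderiv,
      (hF _ hy.2).fderiv]
    exact θ.eq_inChart_comp hy.1

/-- Vanishing can be tested on the coefficients in a chart, which are continuous. This lets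
vanishing pass from a dense orbit to all of M. -/
theorem isClosed_setOf_covectorField_eq_zero {θ : CovectorField I M}
    (hθ : θ ∈ closedOneForms I M) : IsClosed {x | θ x = 0} := by
  have : IsManifold I 1 M := IsManifold.of_le (n := ∞) (one_le_two.trans two_le_infty)
  rw [← isOpen_compl_iff, isOpen_iff_mem_nhds]
  intro x hx
  set φ := extChartAt I x with hφ
  have hz : ∀ z ∈ φ.source, θ.inChart x (φ z) ≠ 0 ↔ θ z ≠ 0 := by
    intro z hz
    refine not_congr ⟨fun h => ?_, fun h => ?_⟩
    · rw [θ.eq_inChart_comp hz, h]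
      exact ContinuousLinearMap.zero_comp _
    · have h' : θ (φ.symm (φ z)) = 0 := by rw [φ.left_inv hz, h]
      rw [CovectorField.inChart, h']
      exact ContinuousLinearMap.zero_comp _
  have hcont : ContinuousAt (fun z => θ.inChart x (φ z)) x :=
    ContinuousAt.comp (((hθ x).1.continuousOn).continuousAt
      ((isOpen_extChartAt_target x).mem_nhds (mem_extChartAt_target x)))
      (continuousAt_extChartAt x)
  have hne := hcont.eventually_ne ((hz x (mem_extChartAt_source x)).2 hx)
  filter_upwards [hne, extChartAt_source_mem_nhds (I := I) x] with z h1 h2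
  exact (hz z h2).1 h1

end Primitive

/-! ### Logarithmic derivatives of circle-valued maps -/

section LogDerivative
open Topology Set ComplexConjugate
variable {E H : Type*} [NormedAddCommGroup E] [NormedSpace ℝ E] [TopologicalSpace H]
  {I : ModelWithCorners ℝ E H}
  {M : Type*} [TopologicalSpace M] [ChartedSpace H M]

variable (I) in
/-- The form `Im(p̄ dp)`, that is `-i p⁻¹ dp` for `p` with values in the unit circle. -/
noncomputable def dlog (p : M → ℂ) : CovectorField I M := fun x =>
  (Complex.imCLM.comp (ContinuousLinearMap.mul ℝ ℂ (conj (p x)))).comp (mfderiv I 𝓘(ℝ, ℂ) p x)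

theorem dlog_apply (p : M → ℂ) (x : M) (v : TangentSpace I x) :
    dlog I p x v = (conj (p x) * (show ℂ from mfderiv I 𝓘(ℝ, ℂ) p x v)).im := rfl

theorem dlog_congr {p q : M → ℂ} {x : M} (h : p =ᶠ[𝓝 x] q) : dlog I p x = dlog I q x := by
  ext v
  rw [dlog_apply, dlog_apply, h.eq_of_nhds, h.mfderiv_eq]

theorem dlog_exp {f : M → ℝ} {x : M} (hf : MDifferentiableAt I 𝓘(ℝ, ℝ) f x) :
    dlog I (fun y => Complex.exp (Complex.I * f y)) x = mfderiv I 𝓘(ℝ, ℝ) f x := by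
  ext v
  have hd : HasFDerivAt (fun t : ℝ => Complex.exp (Complex.I * Complex.ofRealCLM t)) _ (f x) :=
    ((Complex.ofRealCLM.hasFDerivAt (x := f x)).const_mul Complex.I).cexp
  have h := mfderiv_post_apply (φ := fun t : ℝ => Complex.exp (Complex.I * Complex.ofRealCLM t))
    hf hd.differentiableAt v
  rw [hd.fderiv] at h
  rw [dlog_apply]
  set t : ℝ := mfderiv I 𝓘(ℝ, ℝ) f x v with ht
  have h' : (show ℂ from mfderiv I 𝓘(ℝ, ℂ) (fun y => Complex.exp (Complex.I * f y)) x v) =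
      Complex.exp (Complex.I * f x) * (Complex.I * t) := h
  have hn : conj (Complex.exp (Complex.I * f x)) * Complex.exp (Complex.I * f x) = 1 := by
    rw [← Complex.exp_conj, ← Complex.exp_add]; simp
  rw [h', ← mul_assoc, hn]
  simp only [one_mul, Complex.I_mul_im, Complex.ofReal_re]
  exact ht

theorem dlog_mul {p q : M → ℂ} {x : M} (hp : MDifferentiableAt I 𝓘(ℝ, ℂ) p x)
    (hq : MDifferentiableAt I 𝓘(ℝ, ℂ) q x) (hp1 : p x * conj (p x) = 1)
    (hq1 : q x * conj (q x) = 1) :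
    dlog I (fun y => p y * q y) x = dlog I p x + dlog I q x := by
  ext v
  have h := mfderiv_mul_complex_apply hp hq v
  refine Eq.trans ?_ (add_apply _ _ _).symm
  rw [dlog_apply, dlog_apply, dlog_apply, ← Complex.add_im]
  congr 1
  refine (congrArg (fun z => conj (p x * q x) * z) h).trans ?_
  rw [map_mul]
  linear_combination (conj (q x) * (show ℂ from mfderiv I 𝓘(ℝ, ℂ) q x v)) * hp1 +
    (conj (p x) * (show ℂ from mfderiv I 𝓘(ℝ, ℂ) p x v)) * hq1

theorem dlog_const (c : ℂ) (x : M) : dlog I (fun _ : M => c) x = 0 := by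
  ext v
  have h : mfderiv I 𝓘(ℝ, ℂ) (fun _ : M => c) x = 0 := mfderiv_const
  rw [dlog_apply, h]
  exact congrArg Complex.im (mul_zero _)

theorem dlog_comp {p : M → ℂ} (hp : MDifferentiable I 𝓘(ℝ, ℂ) p) {T : M → M} {x : M}
    (hT : MDifferentiableAt I I T x) :
    dlog I (fun y => p (T y)) x = (dlog I p (T x)).comp (mfderiv I I T x) := by
  ext v
  have h := mfderiv_comp_apply (I' := I) x (hp (T x)) hT v
  exact congrArg (fun z : ℂ => (conj (p (T x)) * z).im) h

/-- Near x a smooth branch of the argument of p is a primitive. -/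
theorem exists_isPrimitiveOn_dlog {p : M → ℂ} (hp : ContMDiff I 𝓘(ℝ, ℂ) ∞ p)
    (hp1 : ∀ x, p x * conj (p x) = 1) (x : M) :
    ∃ f U, x ∈ U ∧ IsPrimitiveOn (dlog I p) f U ∧
      ∀ y ∈ U, p y = Complex.exp (Complex.I * f y) := by
  -- The rotation gives q(x) = 1, inside the domain where the principal logarithm is smooth; adding
  -- arg p(x) later undoes it.
  let q : M → ℂ := fun y => conj (p x) * p y
  have hnorm : ∀ y, ‖p y‖ = 1 := fun y => by
    have := congrArg (‖·‖) (hp1 y)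
    simp only [norm_mul, RCLike.norm_conj, norm_one] at this
    nlinarith [norm_nonneg (p y)]
  have hq : ContMDiff I 𝓘(ℝ, ℂ) ∞ q :=
    (contDiff_const.mul contDiff_id : ContDiff ℝ ∞ fun z : ℂ => conj (p x) * z).contMDiff.comp hp
  have hqn : ∀ y, ‖q y‖ = 1 := fun y => by simp [q, hnorm]
  let U : Set M := q ⁻¹' Complex.slitPlane
  have hU : IsOpen U := Complex.isOpen_slitPlane.preimage hq.continuous
  let f : M → ℝ := fun y => (Complex.log (q y)).im + (p x).arg
  have hf : ContMDiffOn I 𝓘(ℝ, ℝ) ∞ f U := by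
    intro y hy
    have h1 : ContDiffAt ℝ ∞ (fun z : ℂ => (Complex.log z).im + (p x).arg) (q y) :=
      (Complex.imCLM.contDiff.contDiffAt.comp (q y)
        ((Complex.contDiffAt_log hy).restrict_scalars ℝ)).add contDiffAt_const
    exact (h1.contMDiffAt.comp y hq.contMDiffAt).contMDiffWithinAt
  have hexp : ∀ y, p y = Complex.exp (Complex.I * f y) := by
    intro y
    have h1 : Complex.exp (Complex.I * (q y).arg) = q y := by
      have := Complex.norm_mul_exp_arg_mul_I (q y)
      rw [hqn] at this
      simpa [mul_comm] using this
    have h2 : Complex.exp (Complex.I * (p x).arg) = p x := by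
      have := Complex.norm_mul_exp_arg_mul_I (p x)
      rw [hnorm] at this
      simpa [mul_comm] using this
    have : Complex.exp (Complex.I * f y) = q y * p x := by
      simp only [f, Complex.log_im]
      push_cast
      rw [mul_add, Complex.exp_add, h1, h2]
    rw [this]
    linear_combination -(p y) * hp1 x
  refine ⟨f, U, ?_, ⟨hU, hf, fun y hy => ?_⟩, fun y _ => hexp y⟩
  · have : q x = 1 := by simp only [q]; rw [mul_comm]; exact hp1 x
    simp [U, this]
  · have hfy := ((hf y hy).contMDiffAt (hU.mem_nhds hy)).mdifferentiableAt (by simp)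
    rw [← dlog_exp hfy]
    exact dlog_congr (Filter.Eventually.of_forall hexp)

theorem unitPhase_mul_conj (u : C^∞⟮I, M; 𝓘(ℝ, ℂ), ℂ⟯) (x : M) :
    u.unitPhase x * conj (u.unitPhase x) = 1 := by
  rw [ContMDiffMap.unitPhase_apply, ← Complex.exp_conj, ← Complex.exp_add]
  simp

/-- Multiplying by a null-homotopic phase does not change the class of the logarithmic
derivative. -/
theorem dlog_sub_dlog_mul_unitPhase_mem (p u : C^∞⟮I, M; 𝓘(ℝ, ℂ), ℂ⟯)
    (hp1 : ∀ x, p x * conj (p x) = 1) :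
    dlog I p - dlog I (p.mulComplex u.unitPhase) ∈ exactOneForms I M := by
  let f : C^∞⟮I, M; 𝓘(ℝ, ℝ), ℝ⟯ :=
    ⟨fun x => -(u x).re, Complex.reCLM.contDiff.neg.contMDiff.comp u.contMDiff⟩
  have he : (u.unitPhase : M → ℂ) = fun y => Complex.exp (Complex.I * f y) := by
    funext y
    rw [ContMDiffMap.unitPhase_apply]
    congr 1
    change _ = Complex.I * ((-(u y).re : ℝ) : ℂ)
    push_cast
    ring
  rw [← neg_sub]
  refine Submodule.neg_mem _ ⟨f, fun x => ?_⟩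
  have h1 := dlog_mul (I := I) (x := x) p.mdifferentiableAt u.unitPhase.mdifferentiableAt (hp1 x)
    (unitPhase_mul_conj u x)
  have h2 := dlog_exp (I := I) (x := x) f.mdifferentiableAt
  rw [← he] at h2
  change dlog I (fun y => p y * u.unitPhase y) x - dlog I p x = _
  rw [h1, h2]
  exact add_sub_cancel_left _ _

variable [I.Boundaryless] [IsManifold I ∞ M]

theorem dlog_mem_closedOneForms {p : M → ℂ} (hp : ContMDiff I 𝓘(ℝ, ℂ) ∞ p)
    (hp1 : ∀ x, p x * conj (p x) = 1) : dlog I p ∈ closedOneForms I M :=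
  mem_closedOneForms_of_exists_primitive fun x =>
    let ⟨f, U, hx, h, _⟩ := exists_isPrimitiveOn_dlog hp hp1 x
    ⟨f, U, hx, h⟩

end LogDerivative

/-! ### Circle-valued maps span the first cohomology -/

/-- A finite set of reals lies in a subgroup which is free of finite rank; the coordinates with
respect to a basis are extended arbitrarily to `ℝ`. -/
theorem exists_integer_coordinates {S : Set ℝ} (hS : S.Finite) :
    ∃ (P : AddSubgroup ℝ) (r : ℕ) (c : Fin r → ℝ) (ψ : Fin r → ℝ → ℤ), S ⊆ P ∧
      (∀ k, ∀ a ∈ P, ∀ b ∈ P, ψ k (a - b) = ψ k a - ψ k b) ∧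
      ∀ a ∈ P, a = ∑ k, c k * ψ k a := by
  classical
  -- N is finitely generated and, inside ℝ, torsion-free, hence free.
  let N := Submodule.span ℤ S
  have : Module.Finite ℤ N := Module.Finite.span_of_finite ℤ hS
  let b := Module.finBasis ℤ N
  refine ⟨N.toAddSubgroup, _, fun k => (b k : ℝ),
    -- The value 0 outside N is a dummy: the conclusions concern only elements of N.
    fun k a => if h : a ∈ N then b.repr ⟨a, h⟩ k else 0, Submodule.subset_span, ?_, ?_⟩
  · intro k x hx y hy
    have hx' : x ∈ N := hx
    have hy' : y ∈ N := hy
    have hxy : x - y ∈ N := N.sub_mem hx' hy'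
    simp only [hx', hy', hxy, dite_true]
    rw [← Finsupp.sub_apply, ← map_sub]
    rfl
  · intro a ha
    have ha' : a ∈ N := ha
    have h := congrArg (Subtype.val) (b.sum_repr ⟨a, ha'⟩)
    simp only [ha', dite_true]
    rw [Submodule.coe_sum] at h
    refine h.symm.trans (Finset.sum_congr rfl fun k _ => ?_)
    simp [mul_comm]

section Span
open Topology Set ComplexConjugate
variable {E H : Type*} [NormedAddCommGroup E] [NormedSpace ℝ E] [TopologicalSpace H]
  {I : ModelWithCorners ℝ E H}
  {M : Type*} [TopologicalSpace M] [ChartedSpace H M]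

theorem hasMFDerivAt_finset_sum {F κ : Type*} [NormedAddCommGroup F] [NormedSpace ℝ F]
    {s : Finset κ} {f : κ → M → F} {x : M} {f' : κ → TangentSpace I x →L[ℝ] F}
    (h : ∀ k ∈ s, HasMFDerivAt I 𝓘(ℝ, F) (f k) x (f' k)) :
    HasMFDerivAt I 𝓘(ℝ, F) (fun y => ∑ k ∈ s, f k y) x
      (show TangentSpace I x →L[ℝ] F from ∑ k ∈ s, f' k) :=
  ⟨tendsto_finsetSum s fun k hk => (h k hk).1, HasFDerivWithinAt.fun_sum fun k hk => (h k hk).2⟩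

variable [I.Boundaryless] [IsManifold I ∞ M]

theorem IsPrimitiveOn.eventually_sub_eq {θ : CovectorField I M} {f f' : M → ℝ} {U U' : Set M}
    (h : IsPrimitiveOn θ f U) (h' : IsPrimitiveOn θ f' U') {x : M} (hx : x ∈ U) (hx' : x ∈ U') :
    ∀ᶠ y in 𝓝 x, f y - f' y = f x - f' x := by
  have : IsManifold I 1 M := IsManifold.of_le (n := ∞) (one_le_two.trans two_le_infty)
  refine eventually_eq_of_mfderiv_eq_zero (I := I) (f := fun y => f y - f' y) ?_
  filter_upwards [h.isOpen.mem_nhds hx, h'.isOpen.mem_nhds hx'] with y hy hy'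
  have hd := (h.mdifferentiableAt hy).hasMFDerivAt.sub (h'.mdifferentiableAt hy').hasMFDerivAt
  refine ⟨hd.mdifferentiableAt, hd.mfderiv.trans ?_⟩
  rw [← h.eq_mfderiv y hy, ← h'.eq_mfderiv y hy']
  exact sub_self _

/-- The difference of two primitives is locally constant, so it takes finitely many values on a
compact set. -/
theorem IsPrimitiveOn.finite_image_sub {θ : CovectorField I M} {f f' : M → ℝ} {U U' : Set M}
    (h : IsPrimitiveOn θ f U) (h' : IsPrimitiveOn θ f' U') {K : Set M} (hK : IsCompact K)
    (hKU : K ⊆ U) (hKU' : K ⊆ U') : ((fun x => f x - f' x) '' K).Finite := by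
  have : CompactSpace K := isCompact_iff_compactSpace.1 hK
  have hl : IsLocallyConstant (fun x : K => f x - f' x) := by
    rw [IsLocallyConstant.iff_eventually_eq]
    intro x
    exact continuous_subtype_val.continuousAt.eventually
      (h.eventually_sub_eq h' (hKU x.2) (hKU' x.2))
  have := hl.range_finite
  rwa [image_eq_range]

/-- Three nested families are needed: U carries the primitives, the compact K makes their
differences take finitely many values, and the open V carries a partition of unity. -/
theorem exists_finite_primitive_cover [CompactSpace M] [T2Space M] {θ : CovectorField I M}
    (hθ : θ ∈ closedOneForms I M) :
    ∃ (t : Finset M) (f : t → M → ℝ) (U K V : t → Set M), (∀ i, IsPrimitiveOn θ (f i) (U i)) ∧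
      (∀ i, IsCompact (K i)) ∧ (∀ i, K i ⊆ U i) ∧ (∀ i, V i ⊆ K i) ∧ (∀ i, IsOpen (V i)) ∧
      ∀ x, ∃ i, x ∈ V i := by
  choose f U hxU hf using exists_isPrimitiveOn hθ
  have hK : ∀ x, ∃ K, K ∈ 𝓝 x ∧ K ⊆ U x ∧ IsCompact K := fun x =>
    local_compact_nhds ((hf x).isOpen.mem_nhds (hxU x))
  choose K hKn hKU hKc using hK
  obtain ⟨t, ht⟩ := CompactSpace.elim_nhds_subcover (fun x => interior (K x))
    (fun x => interior_mem_nhds.2 (hKn x))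
  refine ⟨t, fun i => f i, fun i => U i, fun i => K i, fun i => interior (K i), fun i => hf i,
    fun i => hKc i, fun i => hKU i, fun i => interior_subset, fun i => isOpen_interior, fun x => ?_⟩
  have hx : x ∈ ⋃ y ∈ t, interior (K y) := by rw [ht]; trivial
  obtain ⟨y, hy, hxy⟩ := mem_iUnion₂.1 hx
  exact ⟨⟨y, hy⟩, hxy⟩

/-- On a compact manifold every closed 1-form is, up to an exact form, a real combination of
logarithmic derivatives of maps to the unit circle. -/
theorem exists_sub_sum_dlog_mem_exactOneForms [FiniteDimensional ℝ E] [CompactSpace M] [T2Space M]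
    {θ : CovectorField I M} (hθ : θ ∈ closedOneForms I M) :
    ∃ (r : ℕ) (c : Fin r → ℝ) (p : Fin r → C^∞⟮I, M; 𝓘(ℝ, ℂ), ℂ⟯),
      (∀ k x, p k x * conj (p k x) = 1) ∧ θ - ∑ k, c k • dlog I (p k) ∈ exactOneForms I M := by
  obtain ⟨t, f, U, K, V, hf, hKc, hKU, hVK, hV, hcov⟩ := exists_finite_primitive_cover hθ
  obtain ⟨ρ, hρ⟩ := SmoothPartitionOfUnity.exists_isSubordinate I isClosed_univ V hV
    (fun x _ => mem_iUnion.2 (hcov x))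
  have hfin : (⋃ i, ⋃ j, (fun x => f i x - f j x) '' (K i ∩ K j)).Finite :=
    finite_iUnion fun i => finite_iUnion fun j => (hf i).finite_image_sub (hf j)
      ((hKc i).inter (hKc j)) (inter_subset_left.trans (hKU i)) (inter_subset_right.trans (hKU j))
  obtain ⟨P, r, c, ψ, hSP, hψ, hc⟩ := exists_integer_coordinates hfin
  have hP : ∀ i j x, x ∈ V i → x ∈ V j → f i x - f j x ∈ P := fun i j x hi hj =>
    hSP (mem_iUnion₂.2 ⟨i, j, x, ⟨hVK i hi, hVK j hj⟩, rfl⟩)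
  have hsupp : ∀ j x, ρ j x ≠ 0 → x ∈ V j := fun j x h => hρ j (subset_tsupport _ h)
  have hsum : ∀ x, ∑ j, ρ j x = 1 := fun x => by
    rw [← finsum_eq_sum_of_fintype]; exact ρ.sum_eq_one (mem_univ x)
  -- The partition of unity splits the k-th integral cocycle ψ_k(f_i - f_j) as a coboundary of
  -- smooth functions g_k,i; by `hgdiff` these differ by integers on overlaps.
  let g : Fin r → t → M → ℝ := fun k i x => ∑ j, ρ j x * (ψ k (f i x - f j x) : ℝ)
  have hg : ∀ k i y, y ∈ V i → ContMDiffAt I 𝓘(ℝ, ℝ) ∞ (g k i) y := by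
    intro k i y hy
    have h := ρ.contMDiffAt_finsum (n := ⊤) (x₀ := y) (F := ℝ)
      (g := fun j x => (ψ k (f i x - f j x) : ℝ)) (by
        intro j hj
        -- Differences of primitives are locally constant, so the arbitrary map ψ_k does no harm to
        -- smoothness.
        refine (contMDiffAt_const (c := (ψ k (f i y - f j y) : ℝ))).congr_of_eventuallyEq ?_
        filter_upwards [(hf i).eventually_sub_eq (hf j) (hKU i (hVK i hy))
          (hKU j (hVK j (hρ j hj)))] with x hx
        rw [hx])
    simp only [finsum_eq_sum_of_fintype, smul_eq_mul] at h
    exact h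
  have hgdiff : ∀ k i l y, y ∈ V i → y ∈ V l → g k i y = g k l y + ψ k (f i y - f l y) := by
    intro k i l y hi hl
    have : (ψ k (f i y - f l y) : ℝ) = ∑ j, ρ j y * (ψ k (f i y - f l y) : ℝ) := by
      rw [← Finset.sum_mul, hsum, one_mul]
    rw [this]
    simp only [g]
    rw [← Finset.sum_add_distrib]
    refine Finset.sum_congr rfl fun j _ => ?_
    by_cases h0 : ρ j y = 0
    · simp [h0]
    · have hj := hsupp j y h0
      have h1 := hψ k _ (hP i j y hi hj) _ (hP l j y hl hj)
      rw [show f i y - f j y - (f l y - f j y) = f i y - f l y by ring] at h1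
      rw [h1]
      push_cast
      ring
  -- The average of the primitives is globally smooth, and f_i - h = ∑ c_k g_k,i on V_i by `hcg`; h
  -- will be the primitive of the exact remainder.
  let h : M → ℝ := fun x => ∑ j, ρ j x * f j x
  have hh : ContMDiff I 𝓘(ℝ, ℝ) ∞ h := by
    have h1 := ρ.contMDiff_finsum_smul (n := ⊤) (g := f)
      (fun j x hx => (hf j).contMDiffAt (hKU j (hVK j (hρ j hx))))
    simp only [finsum_eq_sum_of_fintype, smul_eq_mul] at h1
    exact h1
  have hcg : ∀ i y, y ∈ V i → h y = f i y - ∑ k, c k * g k i y := by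
    intro i y hi
    have h1 : ∑ k, c k * g k i y = ∑ j, ρ j y * (f i y - f j y) := by
      simp only [g, Finset.mul_sum]
      rw [Finset.sum_comm]
      refine Finset.sum_congr rfl fun j _ => ?_
      by_cases h0 : ρ j y = 0
      · simp [h0]
      · conv_rhs => rw [hc _ (hP i j y hi (hsupp j y h0)), Finset.mul_sum]
        refine Finset.sum_congr rfl fun k _ => ?_
        ring
    have h2 : f i y = ∑ j, ρ j y * f i y := by rw [← Finset.sum_mul, hsum, one_mul]
    rw [h1]
    simp only [mul_sub, Finset.sum_sub_distrib]
    rw [← h2]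
    simp [h]
  choose ix hix using hcov
  -- The index chosen at x is immaterial, because changing it alters g_k by an integer.
  let q : Fin r → M → ℂ := fun k x =>
    Complex.exp (Complex.I * ((2 * Real.pi * g k (ix x) x : ℝ) : ℂ))
  have hq : ∀ k i y, y ∈ V i →
      q k y = Complex.exp (Complex.I * ((2 * Real.pi * g k i y : ℝ) : ℂ)) := by
    intro k i y hi
    simp only [q]
    rw [hgdiff k _ i y (hix y) hi, Complex.exp_eq_exp_iff_exists_int]
    refine ⟨ψ k (f (ix y) y - f i y), ?_⟩
    push_cast
    ring
  have hqe : ∀ k i y, y ∈ V i →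
      q k =ᶠ[𝓝 y] fun z => Complex.exp (Complex.I * ((2 * Real.pi * g k i z : ℝ) : ℂ)) :=
    fun k i y hi => by
      filter_upwards [(hV i).mem_nhds hi] with z hz using hq k i z hz
  have hqs : ∀ k, ContMDiff I 𝓘(ℝ, ℂ) ∞ (q k) := by
    intro k y
    have h1 : ContDiff ℝ ∞ (fun s : ℝ => Complex.exp (Complex.I *
        Complex.ofRealCLM (2 * Real.pi * s))) :=
      (contDiff_const.mul (Complex.ofRealCLM.contDiff.comp (contDiff_const.mul contDiff_id))).cexp
    exact (h1.contMDiff.contMDiffAt.comp y (hg k _ y (hix y))).congr_of_eventuallyEq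
      (hqe k _ y (hix y))
  -- The factor 1/(2π) compensates `dlog q_k` = 2π dg_k.
  refine ⟨r, fun k => c k / (2 * Real.pi), fun k => ⟨q k, hqs k⟩, fun k x => ?_, ⟨h, hh⟩,
    fun y => ?_⟩
  · change q k x * conj (q k x) = 1
    simp only [q]
    rw [← Complex.exp_conj, ← Complex.exp_add, map_mul, Complex.conj_I, Complex.conj_ofReal,
      neg_mul, add_neg_cancel, Complex.exp_zero]
  · have hi := hix y
    set i := ix y
    have hgd : ∀ k, MDifferentiableAt I 𝓘(ℝ, ℝ) (g k i) y := fun k =>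
      (hg k i y hi).mdifferentiableAt (by simp)
    have hG : ∀ k, HasMFDerivAt I 𝓘(ℝ, ℝ) (fun z => 2 * Real.pi * g k i z) y
        (dlog I (q k) y) := by
      intro k
      have hd : MDifferentiableAt I 𝓘(ℝ, ℝ) (fun z => 2 * Real.pi * g k i z) y :=
        (hgd k).const_smul (2 * Real.pi)
      rw [dlog_congr (hqe k i y hi), dlog_exp hd]
      exact hd.hasMFDerivAt
    have hF := ((hf i).mdifferentiableAt (hKU i (hVK i hi))).hasMFDerivAt
    rw [← (hf i).eq_mfderiv y (hKU i (hVK i hi))] at hF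
    have hS := hF.sub (hasMFDerivAt_finset_sum (s := Finset.univ)
      fun k _ => (hG k).const_smul (c k / (2 * Real.pi)))
    have he : h =ᶠ[𝓝 y] (f i - fun z => ∑ k, ((c k / (2 * Real.pi)) •
        fun z => 2 * Real.pi * g k i z) z) := by
      filter_upwards [(hV i).mem_nhds hi] with z hz
      rw [hcg i z hz]
      simp only [Pi.sub_apply, Pi.smul_apply, smul_eq_mul]
      congr 1
      refine Finset.sum_congr rfl fun k _ => ?_
      field_simp
    have hfin := (hS.congr_of_eventuallyEq he).mfderiv
    refine Eq.trans ?_ hfin.symm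
    change θ y - (∑ k, (c k / (2 * Real.pi)) • dlog I (q k)) y = _
    congr 1
    exact Finset.sum_apply y _ _

end Span

/-! ### Submersions are open, and onto when the source is compact -/

section Submersion
open Topology Set Filter
variable {E H : Type*} [NormedAddCommGroup E] [NormedSpace ℝ E] [TopologicalSpace H]
  {I : ModelWithCorners ℝ E H} [I.Boundaryless] [CompleteSpace E]
  {M : Type*} [TopologicalSpace M] [ChartedSpace H M]
  {E' H' : Type*} [NormedAddCommGroup E'] [NormedSpace ℝ E'] [TopologicalSpace H']
  {I' : ModelWithCorners ℝ E' H'} [I'.Boundaryless] [CompleteSpace E']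
  {N : Type*} [TopologicalSpace N] [ChartedSpace H' N]

/-- In charts the map is strictly differentiable with surjective derivative, so it is open at the
point. -/
theorem map_nhds_eq_of_mfderiv_surjective {f : M → N} {x : M}
    (hf : ContMDiffAt I I' ∞ f x) (hs : Function.Surjective (mfderiv I I' f x)) :
    map f (𝓝 x) = 𝓝 (f x) := by
  obtain ⟨hc, hd⟩ := contMDiffAt_iff.1 hf
  rw [I.range_eq_univ, contDiffWithinAt_univ] at hd
  set W : E → E' := extChartAt I' (f x) ∘ f ∘ (extChartAt I x).symm with hW
  have hmf := (hf.mdifferentiableAt (by simp)).mfderiv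
  rw [I.range_eq_univ, fderivWithin_univ] at hmf
  have hs' : (fderiv ℝ W (extChartAt I x x)).range = ⊤ := by
    rw [hmf] at hs
    exact LinearMap.range_eq_top.2 hs
  have h1 := (hd.hasStrictFDerivAt (by simp)).map_nhds_eq_of_surj hs'
  have hWx : W (extChartAt I x x) = extChartAt I' (f x) (f x) := by simp [hW]
  rw [hWx, ← map_extChartAt_nhds_of_boundaryless x, map_map] at h1
  have h2 := map_extChartAt_symm_nhdsWithin_range (I := I') (f x)
  rw [I'.range_eq_univ, nhdsWithin_univ, ← h1, map_map] at h2
  rw [← h2]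
  refine map_congr ?_
  filter_upwards [extChartAt_source_mem_nhds (I := I) x,
    hc.preimage_mem_nhds (extChartAt_source_mem_nhds (I := I') (f x))] with y hy hy'
  simp only [hW, Function.comp_apply]
  rw [(extChartAt I x).left_inv hy, (extChartAt I' (f x)).left_inv hy']

theorem surjective_of_mfderiv_surjective [CompactSpace M] [Nonempty M] [T2Space N]
    [PreconnectedSpace N] {f : M → N} (hf : ContMDiff I I' ∞ f)
    (hs : ∀ x, Function.Surjective (mfderiv I I' f x)) : Function.Surjective f := by
  have hopen : IsOpenMap f := IsOpenMap.of_nhds_le fun x =>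
    (map_nhds_eq_of_mfderiv_surjective (hf x) (hs x)).ge
  have hclosed : IsClosed (range f) := (isCompact_range hf.continuous).isClosed
  exact range_eq_univ.1 (IsClopen.eq_univ ⟨hclosed, hopen.isOpen_range⟩ (range_nonempty f))

end Submersion

/-! ### Maps to the torus and their derivatives -/

section TorusValued
open Topology Set ComplexConjugate
variable {E H : Type*} [NormedAddCommGroup E] [NormedSpace ℝ E] [TopologicalSpace H]
  {I : ModelWithCorners ℝ E H} {M : Type*} [TopologicalSpace M] [ChartedSpace H M]

instance torusModel_boundaryless (b : ℕ) : (torusModel b).Boundaryless where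
  range_eq_univ := by
    change range (fun (x : ∀ _ : Fin b, EuclideanSpace ℝ (Fin 1)) => fun i => (𝓡 1) (x i)) = univ
    exact range_eq_univ.2 fun y => ⟨y, rfl⟩

theorem contMDiff_torus {b : ℕ} {f : M → Torus b} {m : WithTop ℕ∞}
    (hf : ∀ j, ContMDiff I (𝓡 1) m fun x => f x j) : ContMDiff I (torusModel b) m f := by
  intro x
  refine contMDiffAt_iff.2 ⟨continuousAt_pi.2 fun j => (hf j x).continuousAt, ?_⟩
  exact contDiffWithinAt_pi.2 fun j => (contMDiffAt_iff.1 (hf j x)).2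

theorem hasMFDerivAt_torus {b : ℕ} {f : M → Torus b} {x : M}
    (hf : ∀ j, MDifferentiableAt I (𝓡 1) (fun x => f x j) x) :
    HasMFDerivAt I (torusModel b) f x
      (show TangentSpace I x →L[ℝ] (Fin b → EuclideanSpace ℝ (Fin 1)) from
        ContinuousLinearMap.pi fun j => mfderiv I (𝓡 1) (fun x => f x j) x) :=
  ⟨continuousAt_pi.2 fun j => (hf j).continuousAt,
    hasFDerivWithinAt_pi.2 fun j => (hf j).hasMFDerivAt.2⟩

attribute [local instance] finrank_real_complex_fact' in
theorem contMDiff_circle_coe {m : WithTop ℕ∞} :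
    ContMDiff (𝓡 1) 𝓘(ℝ, ℂ) m (fun z : Circle => (z : ℂ)) := contMDiff_coe_sphere

attribute [local instance] finrank_real_complex_fact' in
theorem contMDiff_circle_of_coe [IsManifold I ∞ M] {f : M → Circle}
    (hf : ContMDiff I 𝓘(ℝ, ℂ) ∞ fun x => (f x : ℂ)) : ContMDiff I (𝓡 1) ∞ f :=
  hf.codRestrict_sphere fun x => (f x).2

/-- A nonzero functional killing a proper image would have as coefficients a linear relation among
the l_j. -/
theorem surjective_pi_of_linearIndependent {V : Type*} [AddCommGroup V] [Module ℝ V] {b : ℕ}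
    {l : Fin b → V →ₗ[ℝ] ℝ} (hl : LinearIndependent ℝ l) :
    Function.Surjective (LinearMap.pi l) := by
  by_contra hns
  have hlt : LinearMap.range (LinearMap.pi l) < ⊤ :=
    lt_top_iff_ne_top.2 fun h => hns (LinearMap.range_eq_top.1 h)
  obtain ⟨φ, hφ, hle⟩ := Submodule.exists_le_ker_of_lt_top _ hlt
  apply hφ
  have ha : ∑ j, φ (Pi.single j 1) • l j = 0 := by
    ext v
    have h := hle ⟨v, rfl⟩
    rw [LinearMap.mem_ker, LinearMap.pi_apply_eq_sum_univ φ] at h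
    simp only [smul_eq_mul] at h
    simp only [LinearMap.sum_apply, LinearMap.smul_apply, smul_eq_mul, LinearMap.zero_apply]
    refine Eq.trans (Finset.sum_congr rfl fun i _ => ?_) h
    rw [mul_comm, show (Pi.single i 1 : Fin b → ℝ) = fun j => if i = j then 1 else 0 by
      ext j; simp [Pi.single_apply, eq_comm]]
    rfl
  have h0 := Fintype.linearIndependent_iff.1 hl _ ha
  ext j
  simpa using h0 j

/-- A map to the torus is a submersion where the logarithmic derivatives of its components are
linearly independent. -/
theorem mfderiv_torus_surjective {b : ℕ} {f : M → Torus b} {x : M}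
    (hf : ∀ j, MDifferentiableAt I (𝓡 1) (fun x => f x j) x)
    (hl : ∀ a : Fin b → ℝ, ∑ j, a j • dlog I (fun y => (f y j : ℂ)) x = 0 → a = 0) :
    Function.Surjective (mfderiv I (torusModel b) f x) := by
  rw [(hasMFDerivAt_torus hf).mfderiv]
  let D : Fin b → E →L[ℝ] EuclideanSpace ℝ (Fin 1) := fun j => mfderiv I (𝓡 1) (fun x => f x j) x
  -- ℓ_j identifies the tangent line of the circle at f_j(x) with ℝ by its angular coordinate.
  let ℓ : Fin b → EuclideanSpace ℝ (Fin 1) →L[ℝ] ℝ := fun j =>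
    (Complex.imCLM.comp (ContinuousLinearMap.mul ℝ ℂ (conj (f x j : ℂ)))).comp
      (mfderiv (𝓡 1) 𝓘(ℝ, ℂ) (fun z : Circle => (z : ℂ)) (f x j))
  have hD : ∀ j, dlog I (fun y => (f y j : ℂ)) x = (ℓ j).comp (D j) := by
    intro j
    ext v
    have h := mfderiv_comp_apply (I' := 𝓡 1) x
      (contMDiff_circle_coe (m := ∞).mdifferentiable (by simp) (f x j)) (hf j) v
    exact congrArg (fun z : ℂ => (conj (f x j : ℂ) * z).im) h
  have hli : LinearIndependent ℝ fun j => ((ℓ j).comp (D j)).toLinearMap := by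
    rw [Fintype.linearIndependent_iff]
    intro a ha
    refine congrFun (hl a ?_)
    simp only [hD]
    have h : ContinuousLinearMap.coeLM ℝ (∑ j, a j • (ℓ j).comp (D j)) = 0 := by
      rw [map_sum]
      simp only [map_smul]
      exact ha
    exact ContinuousLinearMap.coe_injective h
  let Ψ : (Fin b → EuclideanSpace ℝ (Fin 1)) →ₗ[ℝ] (Fin b → ℝ) :=
    LinearMap.pi fun j => (ℓ j).toLinearMap.comp (LinearMap.proj j)
  have hsurj := surjective_pi_of_linearIndependent hli
  have hΨs : Function.Surjective Ψ := fun w =>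
    let ⟨v, hv⟩ := hsurj w
    ⟨fun j => D j v, hv⟩
  -- Source and target of Ψ both have dimension b, so surjectivity gives injectivity, and preimages
  -- found after Ψ are preimages before it.
  have hΨi : Function.Injective Ψ :=
    (LinearMap.injective_iff_surjective_of_finrank_eq_finrank
      (by simp [Module.finrank_pi_fintype])).2 hΨs
  intro w
  obtain ⟨v, hv⟩ := hsurj (Ψ w)
  exact ⟨v, hΨi hv⟩

end TorusValued

/-! ### Invariant logarithmic forms and bases of circle classes -/

section Invariance
open Topology Set ComplexConjugate
variable {E H : Type*} [NormedAddCommGroup E] [NormedSpace ℝ E] [TopologicalSpace H]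
  {I : ModelWithCorners ℝ E H} {M : Type*} [TopologicalSpace M] [ChartedSpace H M]

/-- If `p ∘ T` and `p` differ by a constant phase, then `dlog p` is `T`-invariant. -/
theorem dlog_eq_comp_mfderiv {p : M → ℂ} (hp : MDifferentiable I 𝓘(ℝ, ℂ) p)
    (hp1 : ∀ x, p x * conj (p x) = 1) {T : M → M} {x : M} (hT : MDifferentiableAt I I T x)
    (hpT : ∀ y z, p (T y) * conj (p y) = p (T z) * conj (p z)) :
    dlog I p x = (dlog I p (T x)).comp (mfderiv I I T x) := by
  rw [← dlog_comp hp hT]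
  have he : (fun y => p (T y)) = fun y => (p (T x) * conj (p x)) * p y := by
    funext y
    rw [← hpT y x]
    linear_combination -p (T y) * hp1 y
  have hc : p (T x) * conj (p x) * conj (p (T x) * conj (p x)) = 1 := by
    rw [map_mul, Complex.conj_conj]
    linear_combination (p x * conj (p x)) * hp1 (T x) + hp1 x
  rw [he, dlog_mul mdifferentiableAt_const (hp x) hc (hp1 x), dlog_const]
  exact (zero_add _).symm

variable [I.Boundaryless] [IsManifold I ∞ M]

/-- The logarithmic derivative of a map to the unit circle, as a closed form. -/
noncomputable def closedDlog (p : C^∞⟮I, M; 𝓘(ℝ, ℂ), ℂ⟯) (hp1 : ∀ x, p x * conj (p x) = 1) :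
    closedOneForms I M :=
  ⟨dlog I p, dlog_mem_closedOneForms p.contMDiff hp1⟩

/-- The class in `H¹(M; ℝ)` of the logarithmic derivative of a map to the unit circle. -/
noncomputable def dlogClass (p : C^∞⟮I, M; 𝓘(ℝ, ℂ), ℂ⟯) (hp1 : ∀ x, p x * conj (p x) = 1) :
    DeRhamH1 I M :=
  ((exactOneForms I M).submoduleOf (closedOneForms I M)).mkQ (closedDlog p hp1)

theorem sum_smul_dlogClass {r : ℕ} (a : Fin r → ℝ) (p : Fin r → C^∞⟮I, M; 𝓘(ℝ, ℂ), ℂ⟯)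
    (hp1 : ∀ k x, p k x * conj (p k x) = 1) :
    ∑ k, a k • dlogClass (p k) (hp1 k) =
      ((exactOneForms I M).submoduleOf (closedOneForms I M)).mkQ
        (∑ k, a k • closedDlog (p k) (hp1 k)) := by
  simp only [map_sum, map_smul, dlogClass]

theorem coe_sum_smul_closedDlog {r : ℕ} (a : Fin r → ℝ) (p : Fin r → C^∞⟮I, M; 𝓘(ℝ, ℂ), ℂ⟯)
    (hp1 : ∀ k x, p k x * conj (p k x) = 1) :
    ((∑ k, a k • closedDlog (p k) (hp1 k) : closedOneForms I M) : CovectorField I M) =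
      ∑ k, a k • dlog I (p k) := by
  rw [Submodule.coe_sum]
  rfl

theorem span_dlogClass [FiniteDimensional ℝ E] [CompactSpace M] [T2Space M] :
    Submodule.span ℝ {c : DeRhamH1 I M | ∃ p hp1, dlogClass p hp1 = c} = ⊤ := by
  rw [eq_top_iff]
  rintro c -
  obtain ⟨θ, rfl⟩ := Submodule.mkQ_surjective _ c
  obtain ⟨r, a, p, hp1, hex⟩ := exists_sub_sum_dlog_mem_exactOneForms θ.2
  have h : ((exactOneForms I M).submoduleOf (closedOneForms I M)).mkQ θ =
      ∑ k, a k • dlogClass (p k) (hp1 k) := by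
    rw [sum_smul_dlogClass]
    refine (Submodule.Quotient.eq _).2 (Submodule.mem_comap.2 ?_)
    rw [map_sub]
    simpa only [Submodule.subtype_apply, coe_sum_smul_closedDlog] using hex
  rw [h]
  exact Submodule.sum_mem _ fun k _ =>
    Submodule.smul_mem _ _ (Submodule.subset_span ⟨p k, hp1 k, rfl⟩)

-- A basis is extracted from the spanning set of circle classes. It is indexed by a possibly
-- infinite set, since finiteness of b₁ is deduced from it afterwards.
variable (I M) in
theorem exists_basis_dlogClass [FiniteDimensional ℝ E] [CompactSpace M] [T2Space M] :
    ∃ (B : Set (DeRhamH1 I M)) (bas : Module.Basis B ℝ (DeRhamH1 I M)),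
      ∀ c : B, ∃ p hp1, dlogClass p hp1 = bas c := by
  obtain ⟨B, hBS, hspan, hli⟩ := exists_linearIndependent ℝ
    {c : DeRhamH1 I M | ∃ p hp1, dlogClass p hp1 = c}
  rw [span_dlogClass] at hspan
  refine ⟨B, Module.Basis.mk hli (by simp [hspan]), fun c => ?_⟩
  rw [Module.Basis.mk_apply]
  exact hBS c.2

end Invariance

/-! ### Equivariant representatives and minimality -/

section SmoothAction
variable {EG HG : Type*} [NormedAddCommGroup EG] [NormedSpace ℝ EG]
  [TopologicalSpace HG]
  {G : Type*} [TopologicalSpace G] [ChartedSpace HG G] [Group G]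
  {EM HM : Type*} [NormedAddCommGroup EM] [NormedSpace ℝ EM] [TopologicalSpace HM]
  (IM : ModelWithCorners ℝ EM HM) {M : Type*} [TopologicalSpace M] [ChartedSpace HM M]
  [MulAction G M]

theorem contMDiff_const_smul_of_action (IG : ModelWithCorners ℝ EG HG)
    [ContMDiffSMul IG IM ∞ G M] (g : G) : ContMDiff IM IM ∞ fun x : M => g • x :=
  (ContMDiffSMul.contMDiff_smul (I := IG) (I' := IM) (n := ∞) (G := G) (M := M)).comp
    (contMDiff_const.prodMk contMDiff_id)

theorem contMDiff_smul_const_of_action (IG : ModelWithCorners ℝ EG HG)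
    [ContMDiffSMul IG IM ∞ G M] (x : M) : ContMDiff IG IM ∞ fun g : G => g • x :=
  (ContMDiffSMul.contMDiff_smul (I := IG) (I' := IM) (n := ∞) (G := G) (M := M)).comp
    (contMDiff_id.prodMk contMDiff_const)

end SmoothAction

section Main
open Topology Set ComplexConjugate
variable {EG HG : Type*} [NormedAddCommGroup EG] [NormedSpace ℝ EG]
  [TopologicalSpace HG] {IG : ModelWithCorners ℝ EG HG}
  {G : Type*} [TopologicalSpace G] [ChartedSpace HG G] [Group G]
  {EM HM : Type*} [NormedAddCommGroup EM] [NormedSpace ℝ EM] [TopologicalSpace HM]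
  {IM : ModelWithCorners ℝ EM HM} {M : Type*} [TopologicalSpace M] [ChartedSpace HM M]
  [IsManifold IM ∞ M] [LieGroup IG ∞ G] [MulAction G M] [ContMDiffSMul IG IM ∞ G M]

variable [IM.Boundaryless]

/-- The correction that turns p into an eigenfunction is a null-homotopic phase, so equivariance is
gained without changing the class. -/
theorem exists_equivariant_dlogClass_eq [IG.Boundaryless] [CompleteSpace EG] [PreconnectedSpace G]
    (hH : Function.Surjective (naturalMapH1 IG G IM M)) (p : C^∞⟮IM, M; 𝓘(ℝ, ℂ), ℂ⟯)
    (hp1 : ∀ x, p x * conj (p x) = 1) :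
    ∃ (q : C^∞⟮IM, M; 𝓘(ℝ, ℂ), ℂ⟯) (hq1 : ∀ x, q x * conj (q x) = 1),
      dlogClass q hq1 = dlogClass p hp1 ∧
      ∀ (g : G) (x y : M), q (g • x) * conj (q x) = q (g • y) * conj (q y) := by
  obtain ⟨u, a, ha⟩ := exists_eigenfunction hp1 hH
  have hq1 : ∀ x, (p.mulComplex u.unitPhase) x * conj ((p.mulComplex u.unitPhase) x) = 1 := by
    intro x
    rw [ContMDiffMap.mulComplex_apply, map_mul]
    linear_combination (u.unitPhase x * conj (u.unitPhase x)) * hp1 x + unitPhase_mul_conj u x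
  refine ⟨p.mulComplex u.unitPhase, hq1, ?_, smul_ratio_eq hq1 ha⟩
  have h : closedDlog p hp1 - closedDlog _ hq1 ∈
      (exactOneForms IM M).submoduleOf (closedOneForms IM M) :=
    dlog_sub_dlog_mul_unitPhase_mem p u hp1
  exact ((Submodule.Quotient.eq _).2 h).symm

/-- A combination of logarithmic derivatives of equivariant maps which vanishes at a point vanishes
identically if the action is minimal. -/
theorem eq_zero_of_sum_smul_dlog_eq_zero (IG : ModelWithCorners ℝ EG HG) [LieGroup IG ∞ G]
    [ContMDiffSMul IG IM ∞ G M] [MulAction.IsMinimal G M] {b : ℕ}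
    {q : Fin b → C^∞⟮IM, M; 𝓘(ℝ, ℂ), ℂ⟯} (hq1 : ∀ j x, q j x * conj (q j x) = 1)
    (hqG : ∀ j (g : G) (x y : M), q j (g • x) * conj (q j x) = q j (g • y) * conj (q j y))
    (hli : LinearIndependent ℝ fun j => dlogClass (q j) (hq1 j)) {x : M} (a : Fin b → ℝ)
    (ha : ∑ j, a j • dlog IM (q j) x = 0) : a = 0 := by
  let θ : CovectorField IM M := ∑ j, a j • dlog IM (q j)
  have hθx : ∀ y, θ y = ∑ j, a j • dlog IM (q j) y := fun y => Finset.sum_apply y _ _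
  have hθ : θ ∈ closedOneForms IM M := Submodule.sum_mem _ fun j _ =>
    Submodule.smul_mem _ _ (dlog_mem_closedOneForms (q j).contMDiff (hq1 j))
  have hinv : ∀ (g : G) y v, θ y v = θ (g • y) (mfderiv IM IM (fun z : M => g • z) y v) := by
    intro g y v
    have hj : ∀ j, dlog IM (q j) y v =
        dlog IM (q j) (g • y) (mfderiv IM IM (fun z : M => g • z) y v) := fun j =>
      congrArg (fun L => L v) (dlog_eq_comp_mfderiv (I := IM) (fun z => (q j).mdifferentiableAt)
        (hq1 j) ((contMDiff_const_smul_of_action IM IG g).mdifferentiable (by simp) y) (hqG j g))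
    rw [hθx, hθx]
    simp only [sum_apply, smul_apply]
    exact Finset.sum_congr rfl fun j _ => congrArg (a j • ·) (hj j)
  have hzero : ∀ y, θ y = 0 := by
    have hcl := isClosed_setOf_covectorField_eq_zero hθ
    -- Invariance under g⁻¹ carries a covector at gx back to x, where the form vanishes.
    have horb : MulAction.orbit G x ⊆ {y | θ y = 0} := by
      rintro _ ⟨g, rfl⟩
      have h0 : θ (g⁻¹ • g • x) = 0 := by rw [inv_smul_smul, hθx, ha]
      change θ (g • x) = 0
      ext v
      rw [hinv g⁻¹ (g • x) v, h0]
      rfl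
    intro y
    have hd : Dense (MulAction.orbit G x) := MulAction.IsMinimal.dense_orbit x
    exact hcl.closure_subset_iff.2 horb (hd y)
  have hsum : ∑ j, a j • dlogClass (q j) (hq1 j) = 0 := by
    have h : ∑ j, a j • closedDlog (q j) (hq1 j) = 0 :=
      Subtype.ext ((coe_sum_smul_closedDlog a q hq1).trans (funext hzero))
    rw [sum_smul_dlogClass, h, map_zero]
  exact funext (Fintype.linearIndependent_iff.1 hli a hsum)

/-- Any linearly independent family of circle classes can be represented by equivariant maps. -/
theorem exists_equivariant_family [IG.Boundaryless] [CompleteSpace EG] [PreconnectedSpace G]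
    (hH : Function.Surjective (naturalMapH1 IG G IM M)) {b : ℕ} {c : Fin b → DeRhamH1 IM M}
    (hc : LinearIndependent ℝ c) (hcp : ∀ j, ∃ p hp1, dlogClass p hp1 = c j) :
    ∃ (q : Fin b → C^∞⟮IM, M; 𝓘(ℝ, ℂ), ℂ⟯) (hq1 : ∀ j x, q j x * conj (q j x) = 1),
      (∀ j (g : G) (x y : M), q j (g • x) * conj (q j x) = q j (g • y) * conj (q j y)) ∧
      LinearIndependent ℝ fun j => dlogClass (q j) (hq1 j) := by
  choose p hp1 hp using hcp
  choose q hq1 hqp hqG using fun j => exists_equivariant_dlogClass_eq hH (p j) (hp1 j)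
  refine ⟨q, hq1, hqG, ?_⟩
  simpa only [hqp, hp] using hc

/-- Under the hypotheses of the main theorem `b₁(M) ≤ dim M`; in particular it is finite. -/
theorem finite_deRhamH1 [IG.Boundaryless] [CompleteSpace EG] [PreconnectedSpace G]
    [FiniteDimensional ℝ EM] [CompactSpace M] [T2Space M] [Nonempty M] [MulAction.IsMinimal G M]
    (hH : Function.Surjective (naturalMapH1 IG G IM M)) : Module.Finite ℝ (DeRhamH1 IM M) := by
  obtain ⟨B, bas, hB⟩ := exists_basis_dlogClass IM M
  suffices Finite B from Module.Finite.of_basis bas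
  by_contra hfin
  have hinf : Infinite B := not_finite_iff_infinite.1 hfin
  -- One class more than dim M would give dim M + 1 independent covectors at a single point.
  let e : Fin (Module.finrank ℝ EM + 1) → B := fun j => Infinite.natEmbedding B j
  have he : Function.Injective e := (Infinite.natEmbedding B).injective.comp Fin.val_injective
  obtain ⟨q, hq1, hqG, hli⟩ := exists_equivariant_family hH (bas.linearIndependent.comp e he)
    fun j => hB (e j)
  let x : M := Classical.arbitrary M
  let l : Fin (Module.finrank ℝ EM + 1) → EM →L[ℝ] ℝ := fun j => dlog IM (q j) x
  have hl : LinearIndependent ℝ fun j => (l j).toLinearMap := by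
    rw [Fintype.linearIndependent_iff]
    intro a ha
    refine congrFun (eq_zero_of_sum_smul_dlog_eq_zero IG hq1 hqG hli (x := x) a ?_)
    have h : ContinuousLinearMap.coeLM ℝ (∑ j, a j • l j) = 0 := by
      rw [map_sum]
      simp only [map_smul]
      exact ha
    exact ContinuousLinearMap.coe_injective h
  have hcard := LinearMap.finrank_le_finrank_of_surjective (surjective_pi_of_linearIndependent hl)
  simp at hcard

end Main

theorem mainTheorem6 {n d : ℕ}
    {G : Type*} [TopologicalSpace G] [ChartedSpace (EuclideanSpace ℝ (Fin n)) G] [Group G]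
    [LieGroup (𝓡 n) ∞ G] [ConnectedSpace G]
    {M : Type*} [TopologicalSpace M] [CompactSpace M] [T2Space M]
    [ChartedSpace (EuclideanSpace ℝ (Fin d)) M] [IsManifold (𝓡 d) ∞ M]
    [MeasurableSpace M] [BorelSpace M]
    [MulAction G M] [ContMDiffSMul (𝓡 n) (𝓡 d) ∞ G M]
    (hmin : MulAction.IsMinimal G M)
    (hμ : ∃ μ : Measure M, IsProbabilityMeasure μ ∧ SMulInvariantMeasure G M μ)
    (hH : Function.Bijective (naturalMapH1 (𝓡 n) G (𝓡 d) M)) :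
    ∃ (π : M → Torus (firstBetti (𝓡 d) M)) (τ : G →* Torus (firstBetti (𝓡 d) M)),
      ContMDiff (𝓡 d) (torusModel (firstBetti (𝓡 d) M)) ∞ π ∧
      (∀ x : M, Function.Surjective (mfderiv (𝓡 d) (torusModel (firstBetti (𝓡 d) M)) π x)) ∧
      Function.Surjective π ∧
      ContMDiff (𝓡 n) (torusModel (firstBetti (𝓡 d) M)) ∞ τ ∧
      ∀ (g : G) (x : M), π (g • x) = τ g * π x := by
  obtain ⟨μ, hprob, -⟩ := hμ
  have hne : Nonempty M := nonempty_of_isProbabilityMeasure μ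
  -- Finiteness must come first: `finrank` is 0 on an infinite-dimensional space, and `firstBetti`
  -- would then not count a basis.
  have hfd : Module.Finite ℝ (DeRhamH1 (𝓡 d) M) := finite_deRhamH1 hH.2
  obtain ⟨B, bas, hB⟩ := exists_basis_dlogClass (𝓡 d) M
  have : Fintype B := FiniteDimensional.fintypeBasisIndex bas
  let e : Fin (firstBetti (𝓡 d) M) ≃ B :=
    (Fintype.equivFinOfCardEq (Module.finrank_eq_card_basis bas).symm).symm
  obtain ⟨q, hq1, hqG, hqli⟩ := exists_equivariant_family hH.2
    (bas.linearIndependent.comp e e.injective) fun j => hB (e j)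
  have hnorm : ∀ j x, q j x ∈ Submonoid.unitSphere ℂ := fun j x => by
    have h : ‖q j x‖ * ‖q j x‖ = 1 := by
      have := congrArg (‖·‖) (hq1 j x)
      simpa only [norm_mul, RCLike.norm_conj, norm_one] using this
    have h1 : ‖q j x‖ = 1 := by nlinarith [norm_nonneg (q j x)]
    simpa [Submonoid.unitSphere] using h1
  let π : M → Torus (firstBetti (𝓡 d) M) := fun x j => ⟨q j x, hnorm j x⟩
  have hπj : ∀ j, ContMDiff (𝓡 d) (𝓡 1) ∞ fun x => π x j := fun j =>
    contMDiff_circle_of_coe (q j).contMDiff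
  have hπ : ContMDiff (𝓡 d) (torusModel (firstBetti (𝓡 d) M)) ∞ π := contMDiff_torus hπj
  have hsub : ∀ x : M, Function.Surjective
      (mfderiv (𝓡 d) (torusModel (firstBetti (𝓡 d) M)) π x) := fun x =>
    mfderiv_torus_surjective (fun j => (hπj j).mdifferentiable (by simp) x) fun a ha =>
      eq_zero_of_sum_smul_dlog_eq_zero (𝓡 n) (G := G) hq1 hqG hqli a ha
  let x₀ : M := Classical.choice hne
  have hratio : ∀ (g : G) (x y : M), π (g • x) * (π x)⁻¹ = π (g • y) * (π y)⁻¹ := by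
    intro g x y
    funext j
    apply Circle.ext
    simp only [Pi.mul_apply, Pi.inv_apply, Circle.coe_mul, Circle.coe_inv_eq_conj]
    exact hqG j g x y
  -- The ratio π(gx)/π(x) does not depend on x. Multiplicativity follows on evaluating the ratio for
  -- g at h • x₀ instead of x₀.
  let τ : G →* Torus (firstBetti (𝓡 d) M) :=
    { toFun := fun g => π (g • x₀) * (π x₀)⁻¹
      map_one' := by simp
      map_mul' := fun g h => by
        rw [hratio g x₀ (h • x₀), mul_smul]
        group }
  refine ⟨π, τ, hπ, hsub, surjective_of_mfderiv_surjective hπ hsub, ?_, fun g x => ?_⟩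
  · refine contMDiff_torus fun j => contMDiff_circle_of_coe ?_
    have h1 : ContMDiff (𝓡 n) 𝓘(ℝ, ℂ) ∞ fun g : G => q j (g • x₀) :=
      (q j).contMDiff.comp (contMDiff_smul_const_of_action (𝓡 d) (𝓡 n) x₀)
    have h2 : ContDiff ℝ ∞ fun z : ℂ => z * (((π x₀)⁻¹ j : Circle) : ℂ) :=
      contDiff_id.mul contDiff_const
    exact h2.contMDiff.comp h1
  · change π (g • x) = π (g • x₀) * (π x₀)⁻¹ * π x
    rw [← hratio g x x₀, inv_mul_cancel_right]
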